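/- Let $k=\mathbb Z[X,Y,Z^{\pm1}]/(X^2=Y^2=1)$, graded by $\mathbb Z_2\times\mathbb Z$ (the splitting degree $\mathrm{sdeg}$) with $\mathrm{sdeg}\,X=\mathrm{sdeg}\,Y=(1,0)$ and $\mathrm{sdeg}\,Z=(0,-1)$. For an oriented planar link diagram $D$ with arrows over its crossings and ordered circles in each resolution, let $D_\xi$ be the vertices of the cube of resolutions and regard its edges $\zeta$ as saddle cobordisms $D_\zeta$ in the $k$-linear category $k\mathbf{ChCob}$ of chronological cobordisms modulo the chronological relations with parameters $X,Y,Z$. A sign assignment is a $1$-cochain $\epsilon$ on the cube with values in $k^*$ such that the cube with edges $\epsilon(\zeta)D_\zeta$ anticommutes. It defines the generalized Khovanov complex $Kh(D)$, with $Kh(D)^q=\bigoplus_{|\xi|=q+n_-}D_\xi$ and differential $\sum_\zeta\epsilon(\zeta)D_\zeta$, in the additive closure of $k\mathbf{ChCob}$, where $n_-$ is the number of negative crossings. Applying the chronological TQFT $\mathcal F$, which sends $m$ circles to $A^{\otimes m}$ with $A=kv_+\oplus kv_-$, gives a complex $\mathcal FKh(D)$ of $k$-modules. For a ring automorphism $\varphi$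 of $k$ that preserves $\mathrm{sdeg}$, let $\mathcal F_\varphi Kh_\varphi(D)$ be the complex of $k$-modules constructed in the same way, with $X,Y,Z$ replaced by $\varphi(X),\varphi(Y),\varphi(Z)$ in the chronological relations and in the TQFT. Assume $\varphi(XY)=XY$. Then $\mathcal FKh(D)$ and $\mathcal F_\varphi Kh_\varphi(D)$ are isomorphic as complexes of $k$-modules, for every link diagram $D$ and all sign assignments $\epsilon$ over $k$ and $\epsilon'$ over the twisted parameters with corresponding coboundaries, $\delta\epsilon'=\varphi(\delta\epsilon)$. Moreover, $\varphi(\epsilon)$ is a sign assignment for the twisted parameters, and if $\epsilon'=\varphi(\epsilon)$, an isomorphism is given on the generators $u=v_{i_1}\otimes\dots\otimes v_{i_m}\in\mathcal F(D_\xi)$ by $$u\longmapsto\Big(\frac{\varphi(X)}X\Big)^a\Big(\frac{\varphi(Z)}Z\Big)^b u,\qquad (a,b)=\mathrm{sdeg}_{A^{\otimes m}}(u)-\mathrm{sdeg}(W_\xi).$$ Here $\mathrm{sdeg}_{A^{\otimes m}}(u)=(s,s)$, where $s$ is minus the sum of the positions, counted from the right and starting with $1$, of the factors $v_-$ of $u$.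 The degree $\mathrm{sdeg}(W_\xi)$ is the splitting degree of the composition of the edges $\epsilon(\zeta)D_\zeta$ along any chosen directed path from the initial vertex to $\xi$; it is the sum of the degrees of the scalars and of the elementary cobordisms, which have $\mathrm{sdeg}$ equal to $(0,0)$ for a merge, $(0,-2)$ for a split and $(1,0)$ for a twist, increased by $(p\alpha+r\beta,(p+r)\beta)$ if there are $p$ tubes on the left and $r$ tubes on the right of an elementary cobordism of chronological degree $(\alpha,\beta)$ (this is $(-1,0)$, $(0,-1)$ and $(0,0)$ respectively). -/

import Mathlib

open CategoryTheory CategoryTheory.Limits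

noncomputable section

namespace GenKh

/-! ### The coefficient ring and its splitting degree -/

/-- The coefficient ring `ℤ[X, Y, Z, Z⁻¹]/(X² = Y² = 1)`, as the group ring of `ℤ/2 × ℤ/2 × ℤ`;
the basis element `(a, b, c)` is the monomial `X ^ a * Y ^ b * Z ^ c`. -/
abbrev Coeff : Type := AddMonoidAlgebra ℤ (ZMod 2 × ZMod 2 × ℤ)

/-- The monomial `X ^ a * Y ^ b * Z ^ c`, where `m = (a, b, c)`. -/
def mono (m : ZMod 2 × ZMod 2 × ℤ) : Coeff := AddMonoidAlgebra.single m 1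

theorem mono_mul (m m' : ZMod 2 × ZMod 2 × ℤ) : mono m * mono m' = mono (m + m') := by
  simp [mono, AddMonoidAlgebra.single_mul_single]

theorem mono_zero : mono 0 = 1 := rfl

/-- Monomials are units. -/
def monoUnit (m : ZMod 2 × ZMod 2 × ℤ) : Coeffˣ where
  val := mono m
  inv := mono (-m)
  val_inv := by rw [mono_mul, add_neg_cancel, mono_zero]
  inv_val := by rw [mono_mul, neg_add_cancel, mono_zero]

/-- The parameters `X`, `Y`, `Z`, as units of the coefficient ring. -/
def X : Coeffˣ := monoUnit (1, 0, 0)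

def Y : Coeffˣ := monoUnit (0, 1, 0)

def Z : Coeffˣ := monoUnit (0, 0, 1)

/-- The group in which splitting degrees take values. -/
abbrev SDeg : Type := ZMod 2 × ℤ

/-- The homogeneous elements of splitting degree `d` of the coefficient ring:
`X` and `Y` have degree `(1, 0)`, and `Z` has degree `(0, -1)`. -/
def coeffGrade (d : SDeg) : Submodule ℤ Coeff :=
  AddMonoidAlgebra.gradeBy ℤ (fun m : ZMod 2 × ZMod 2 × ℤ => (m.1 + m.2.1, -m.2.2)) d

/-- The splitting degree of a nonzero homogeneous scalar (every unit is homogeneous). -/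
def sdegScalar (c : Coeff) : SDeg := Classical.epsilon fun d => c ∈ coeffGrade d

/-- The bicharacter `λ(a, b, a', b') = X ^ (a a') Y ^ (b b') Z ^ (a b' - a' b)`. -/
def lam (p q : ℤ × ℤ) : Coeff :=
  mono (((p.1 * q.1 : ℤ) : ZMod 2), ((p.2 * q.2 : ℤ) : ZMod 2), p.1 * q.2 - q.1 * p.2)

/-! ### Chronological cobordisms -/

/-- The elementary chronological cobordisms, indexed by numbers of input and output circles.
The critical points of `merge` and `split` are oriented from the left circle to the right one
and from the back to the front, respectively. -/
inductive Surf : ℕ → ℕ → Type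
  | merge : Surf 2 1
  | split : Surf 1 2
  | birth : Surf 0 1
  | deathPos : Surf 1 0
  | deathNeg : Surf 1 0
  | twist : Surf 2 2

/-- The chronological degree `(#births - #merges, #deaths - #splits)`. -/
def Surf.deg : {a b : ℕ} → Surf a b → ℤ × ℤ
  | _, _, .merge => (-1, 0)
  | _, _, .split => (0, -1)
  | _, _, .birth => (1, 0)
  | _, _, .deathPos => (0, 1)
  | _, _, .deathNeg => (0, 1)
  | _, _, .twist => (0, 0)

/-- The splitting degree of an elementary cobordism. -/
def Surf.sdeg : {a b : ℕ} → Surf a b → SDeg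
  | _, _, .merge => (0, 0)
  | _, _, .split => (0, -2)
  | _, _, .birth => (0, 0)
  | _, _, .deathPos => (0, 1)
  | _, _, .deathNeg => (1, 1)
  | _, _, .twist => (1, 0)

/-- Elementary cobordisms with vertical tubes on both sides: `elem g r` is `g` with `r` tubes
to its right, and `cyl g` is `g` with one more tube on the left. -/
inductive Gen : ℕ → ℕ → Type
  | elem {a b : ℕ} (g : Surf a b) (r : ℕ) : Gen (r + a) (r + b)
  | cyl {a b : ℕ} (g : Gen a b) : Gen (a + 1) (b + 1)

/-- Adding `n` tubes on the left. -/
def Gen.cyls {a b : ℕ} (g : Gen a b) : (n : ℕ) → Gen (a + n) (b + n)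
  | 0 => g
  | n + 1 => .cyl (g.cyls n)

/-- The chronological degree; it is not changed by tubes. -/
def Gen.deg : {a b : ℕ} → Gen a b → ℤ × ℤ
  | _, _, .elem g _ => g.deg
  | _, _, .cyl g => g.deg

/-- The splitting degree. If `g` has chronological degree `(α, β)`, then adding `k` tubes on the
left and `l` tubes on the right changes the splitting degree by `(k α + l β, (k + l) β)`. -/
def Gen.sdeg : {a b : ℕ} → Gen a b → SDeg
  | _, _, .elem g r => g.sdeg + (((r * g.deg.2 : ℤ) : ZMod 2), r * g.deg.2)
  | _, _, .cyl g => g.sdeg + ((g.deg.1 : ZMod 2), g.deg.2)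

/-- A chronological cobordism from `a` to `b` circles, decomposed into elementary ones, with the
first one at the bottom; `id` is a collection of vertical tubes. -/
inductive Cob : ℕ → ℕ → Type
  | id (a : ℕ) : Cob a a
  | snoc {a b c : ℕ} (W : Cob a b) (g : Gen b c) : Cob a c

/-- Stacking of cobordisms, the first one at the bottom. -/
def Cob.comp {a b c : ℕ} (V : Cob a b) : Cob b c → Cob a c
  | .id _ => V
  | .snoc W g => .snoc (V.comp W) g

/-- Adding a vertical tube on the left. -/
def Cob.cyl : {a b : ℕ} → Cob a b → Cob (a + 1) (b + 1)
  | _, _, .id a => .id (a + 1)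
  | _, _, .snoc W g => .snoc W.cyl (.cyl g)

/-- The chronological degree, additive under composition. -/
def Cob.deg : {a b : ℕ} → Cob a b → ℤ × ℤ
  | _, _, .id _ => 0
  | _, _, .snoc W g => W.deg + g.deg

/-- The splitting degree, additive under composition. -/
def Cob.sdeg : {a b : ℕ} → Cob a b → SDeg
  | _, _, .id _ => 0
  | _, _, .snoc W g => W.sdeg + g.sdeg

/-- An elementary cobordism as a cobordism. -/
def Gen.toCob {a b : ℕ} (g : Gen a b) : Cob a b := .snoc (.id a) g

/-- Elementary cobordisms with `r` vertical tubes to the right. -/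
abbrev merge (r : ℕ) : Cob (r + 2) (r + 1) := (Gen.elem .merge r).toCob

abbrev split (r : ℕ) : Cob (r + 1) (r + 2) := (Gen.elem .split r).toCob

abbrev birth (r : ℕ) : Cob r (r + 1) := (Gen.elem .birth r).toCob

abbrev deathPos (r : ℕ) : Cob (r + 1) r := (Gen.elem .deathPos r).toCob

abbrev deathNeg (r : ℕ) : Cob (r + 1) r := (Gen.elem .deathNeg r).toCob

abbrev twist (r : ℕ) : Cob (r + 2) (r + 2) := (Gen.elem .twist r).toCob

theorem Cob.id_comp : {a b : ℕ} → (W : Cob a b) → (Cob.id a).comp W = W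
  | _, _, .id _ => rfl
  | _, _, .snoc W g => congrArg (Cob.snoc · g) W.id_comp

theorem Cob.comp_assoc {a b c : ℕ} (U : Cob a b) (V : Cob b c) :
    {d : ℕ} → (W : Cob c d) → (U.comp V).comp W = U.comp (V.comp W)
  | _, .id _ => rfl
  | _, .snoc W g => congrArg (Cob.snoc · g) (U.comp_assoc V W)

/-- The defining relations between chronological cobordisms: `ChRel U c V` stands for `U = c V`.
The first group consists of the chronological relations, the second one of the
diffeomorphisms that involve twists. Compositions are written from bottom to top, and a relation
may be placed to the right of any number of vertical tubes. -/
inductive ChRel : {a b : ℕ} → Cob a b → Coeff → Cob a b → Prop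
  -- reversing the orientation of a critical point
  | merge_reverse (r) : ChRel ((twist r).comp (merge r)) X (merge r)
  | split_reverse (r) : ChRel ((split r).comp (twist r)) Y (split r)
  | death_reverse (r) : ChRel (deathNeg r) Y (deathPos r)
  -- creation and annihilation of critical points
  | birth_merge (r) : ChRel ((birth (r + 1)).comp (merge r)) 1 (.id (r + 1))
  | split_deathPos (r) : ChRel ((split r).comp (deathPos r).cyl) 1 (.id (r + 1))
  | split_deathNeg (r) : ChRel ((split r).comp (deathNeg (r + 1))) 1 (.id (r + 1))
  -- exchanging two critical points
  | merge_merge (r) :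
      ChRel ((merge (r + 1)).comp (merge r)) X ((merge r).cyl.comp (merge r))
  | split_split (r) :
      ChRel ((split r).comp (split (r + 1))) Y ((split r).comp (split r).cyl)
  | split_merge (r) :
      ChRel ((split (r + 1)).comp (merge r).cyl) Z ((merge r).comp (split r))
  | split_merge' (r) :
      ChRel ((split r).cyl.comp (merge (r + 1))) Z ((merge r).comp (split r))
  | disjoint {a b m m' : ℕ} (g : Surf a b) (h : Gen m m') :
      ChRel ((Gen.elem g m).toCob.comp (h.cyls b).toCob) (lam h.deg g.deg)
        ((h.cyls a).toCob.comp (Gen.elem g m').toCob)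
  -- twists form a symmetry, natural with respect to the elementary cobordisms
  | twist_twist (r) : ChRel ((twist r).comp (twist r)) 1 (.id (r + 2))
  | twist_braid (r) :
      ChRel (((twist (r + 1)).comp (twist r).cyl).comp (twist (r + 1))) 1
        (((twist r).cyl.comp (twist (r + 1))).comp (twist r).cyl)
  | merge_twist (r) :
      ChRel ((merge r).cyl.comp (twist r)) 1
        (((twist (r + 1)).comp (twist r).cyl).comp (merge (r + 1)))
  | split_twist (r) :
      ChRel (((split r).cyl.comp (twist (r + 1))).comp (twist r).cyl) 1
        ((twist r).comp (split (r + 1)))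
  | birth_twist (r) : ChRel ((birth r).cyl.comp (twist r)) 1 (birth (r + 1))
  | deathPos_twist (r) : ChRel ((twist r).comp (deathPos (r + 1))) 1 (deathPos r).cyl
  | deathNeg_twist (r) : ChRel ((twist r).comp (deathNeg (r + 1))) 1 (deathNeg r).cyl
  -- tubes on the left
  | cyl {a b : ℕ} {U V : Cob a b} {c : Coeff} : ChRel U c V → ChRel U.cyl c V.cyl

/-- Disjoint unions of circles. (The universe level is the one of the category of modules.) -/
structure Circles : Type 1 where
  /-- the number of circles -/
  num : ℕ

instance : Category.{0} Circles where
  Hom a b := Cob a.num b.num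
  id a := .id a.num
  comp V W := V.comp W
  id_comp W := W.id_comp
  comp_id _ := rfl
  assoc U V W := U.comp_assoc V W

section ChCob

variable {R : Type} [CommRing R] (θ : Coeff →+* R)

/-- The linear combinations of cobordisms that the defining relations, with the parameters
replaced by their images under `θ`, make vanish. -/
def relIdeal (a b : Free R Circles) : Submodule R (a ⟶ b) :=
  Submodule.span R {f | ∃ (m n : Circles) (p : a ⟶ (Free.embedding R Circles).obj m)
    (U V : m ⟶ n) (c : Coeff) (q : (Free.embedding R Circles).obj n ⟶ b), ChRel U c V ∧
    f = p ≫ ((Free.embedding R Circles).map U - θ c • (Free.embedding R Circles).map V) ≫ q}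

/-- Two linear combinations of cobordisms are identified. -/
def chHomRel : HomRel (Free R Circles) := fun a b f g => f - g ∈ relIdeal θ a b

theorem relIdeal_comp {a b c : Free R Circles} {f : a ⟶ b} (hf : f ∈ relIdeal θ a b)
    (g : b ⟶ c) : f ≫ g ∈ relIdeal θ a c := by
  refine Submodule.span_induction (p := fun f _ => f ≫ g ∈ relIdeal θ a c) ?_ ?_ ?_ ?_ hf
  · rintro _ ⟨m, n, p, U, V, c, q, h, rfl⟩
    exact Submodule.subset_span ⟨m, n, p, U, V, c, q ≫ g, h, by simp⟩
  · simp
  · intro x y _ _ hx hy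
    rw [Preadditive.add_comp]
    exact add_mem hx hy
  · intro r x _ hx
    rw [Linear.smul_comp]
    exact Submodule.smul_mem _ _ hx

theorem comp_relIdeal {a b c : Free R Circles} (g : a ⟶ b) {f : b ⟶ c}
    (hf : f ∈ relIdeal θ b c) : g ≫ f ∈ relIdeal θ a c := by
  refine Submodule.span_induction (p := fun f _ => g ≫ f ∈ relIdeal θ a c) ?_ ?_ ?_ ?_ hf
  · rintro _ ⟨m, n, p, U, V, c, q, h, rfl⟩
    exact Submodule.subset_span ⟨m, n, g ≫ p, U, V, c, q, h, by simp⟩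
  · simp
  · intro x y _ _ hx hy
    rw [Preadditive.comp_add]
    exact add_mem hx hy
  · intro r x _ hx
    rw [Linear.comp_smul]
    exact Submodule.smul_mem _ _ hx

instance : Congruence (chHomRel θ) where
  comp_left f g g' h := by
    have := comp_relIdeal θ f h
    rwa [Preadditive.comp_sub] at this
  comp_right g h := by
    have := relIdeal_comp θ h g
    rwa [Preadditive.sub_comp] at this
  equivalence :=
    { refl := fun f => by simp [chHomRel]
      symm := fun {f g} h => by
        have := neg_mem h
        rwa [neg_sub] at this
      trans := fun {f g k} h h' => by
        have := add_mem h h'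
        rwa [sub_add_sub_cancel] at this }

/-- The linear category of chronological cobordisms with coefficients in `R`, the parameters
being the images of `X`, `Y`, `Z` under `θ`. -/
abbrev ChCob : Type 1 := Quotient (chHomRel θ)

theorem chHomRel_add ⦃a b : Free R Circles⦄ (f₁ f₂ g₁ g₂ : a ⟶ b) (hf : chHomRel θ f₁ f₂)
    (hg : chHomRel θ g₁ g₂) : chHomRel θ (f₁ + g₁) (f₂ + g₂) := by
  have := add_mem hf hg
  rwa [sub_add_sub_comm] at this

theorem chHomRel_smul (r : R) ⦃a b : Free R Circles⦄ (f₁ f₂ : a ⟶ b)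
    (hf : chHomRel θ f₁ f₂) : chHomRel θ (r • f₁) (r • f₂) := by
  have := Submodule.smul_mem _ r hf
  rwa [smul_sub] at this

instance : Preadditive (ChCob θ) := Quotient.preadditive _ (chHomRel_add θ)

instance : (Quotient.functor (chHomRel θ)).Additive :=
  Quotient.functor_additive _ (chHomRel_add θ)

instance : Linear R (ChCob θ) := Quotient.linear R _ (chHomRel_smul θ)

/-- `m` circles, as an object of the category of chronological cobordisms. -/
def ChCob.circles (m : ℕ) : ChCob θ :=
  (Quotient.functor (chHomRel θ)).obj ((Free.embedding R Circles).obj ⟨m⟩)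

/-- The morphism given by a cobordism. -/
def ChCob.mk {a b : ℕ} (W : Cob a b) : ChCob.circles θ a ⟶ ChCob.circles θ b :=
  (Quotient.functor (chHomRel θ)).map
    ((Free.embedding R Circles).map (X := ⟨a⟩) (Y := ⟨b⟩) W)

end ChCob

/-! ### The chronological TQFT -/

/-- The generators `v₊` and `v₋` of the module `A` of a circle. -/
inductive VGen : Type
  | plus : VGen
  | minus : VGen

/-- The chronological degrees of `v₊` and `v₋`. -/
def VGen.deg : VGen → ℤ × ℤ
  | .plus => (1, 0)
  | .minus => (0, -1)

/-- The splitting degrees of `v₊` and `v₋`. -/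
def VGen.sdeg : VGen → SDeg
  | .plus => (0, 0)
  | .minus => (1, -1)

/-- The generators of the `n`-th tensor power of `A`; `cons s w` is `s ⊗ w`. -/
inductive Word : ℕ → Type
  | nil : Word 0
  | cons {n : ℕ} (s : VGen) (w : Word n) : Word (n + 1)

/-- The splitting degree of a generator of the `n`-th tensor power of `A`. It is determined by
`sdeg (u ⊗ w) = sdeg u + sdeg w + (β k, β k)`, where `u` has chronological degree `(α, β)` and
`w` has weight `k`; the weight of a generator is the number of its factors. -/
def Word.sdeg : {n : ℕ} → Word n → SDeg
  | _, .nil => 0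
  | n + 1, .cons s w => s.sdeg + w.sdeg + (((s.deg.2 * n : ℤ) : ZMod 2), s.deg.2 * n)

section TQFT

variable {R : Type} [CommRing R] (θ : Coeff →+* R)

/-- The map `f ⊗ id` for the linear map `f` of an elementary cobordism, on generators. -/
def Surf.act : {a b : ℕ} → Surf a b → (r : ℕ) → Word (r + a) → (Word (r + b) →₀ R)
  | _, _, .merge, _, .cons .plus (.cons .plus w) => .single (.cons .plus w) 1
  | _, _, .merge, _, .cons .plus (.cons .minus w) => .single (.cons .minus w) 1
  | _, _, .merge, _, .cons .minus (.cons .plus w) => .single (.cons .minus w) (θ (X * Z))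
  | _, _, .merge, _, .cons .minus (.cons .minus _) => 0
  | _, _, .split, _, .cons .plus w =>
      .single (.cons .minus (.cons .plus w)) 1 + .single (.cons .plus (.cons .minus w)) (θ (Y * Z))
  | _, _, .split, _, .cons .minus w => .single (.cons .minus (.cons .minus w)) 1
  | _, _, .birth, _, w => .single (.cons .plus w) 1
  | _, _, .deathPos, _, .cons .plus _ => 0
  | _, _, .deathPos, _, .cons .minus w => .single w (θ Y)
  | _, _, .deathNeg, _, .cons .plus _ => 0
  | _, _, .deathNeg, _, .cons .minus w => .single w 1
  | _, _, .twist, _, .cons s (.cons t w) => .single (.cons t (.cons s w)) (θ (lam s.deg t.deg))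

/-- The map `x ↦ s ⊗ x`. -/
def consMap (s : VGen) (n : ℕ) : (Word n →₀ R) →ₗ[R] (Word (n + 1) →₀ R) :=
  Finsupp.lmapDomain R R (Word.cons s)

/-- The linear map of an elementary cobordism with tubes. A tube on the left corresponds to the
graded tensor product `(id ⊗ f)(s ⊗ w) = λ(deg f, deg s) s ⊗ f(w)`. -/
def Gen.act : {a b : ℕ} → Gen a b → (Word a →₀ R) →ₗ[R] (Word b →₀ R)
  | _, _, .elem g r => Finsupp.linearCombination R (g.act θ r)
  | _, _, .cyl (b := b) g => Finsupp.linearCombination R fun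
      | .cons s w => θ (lam g.deg s.deg) • consMap s b (g.act (.single w 1))

/-- The linear map of a cobordism. -/
def Cob.act : {a b : ℕ} → Cob a b → (Word a →₀ R) →ₗ[R] (Word b →₀ R)
  | _, _, .id _ => LinearMap.id
  | _, _, .snoc W g => (g.act θ).comp W.act

theorem Cob.act_comp {a b c : ℕ} (V : Cob a b) :
    (W : Cob b c) → (V.comp W).act θ = (W.act θ).comp (V.act θ)
  | .id _ => by simp [Cob.comp, Cob.act]
  | .snoc W g => by
    simp only [Cob.comp, Cob.act, V.act_comp W, LinearMap.comp_assoc]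

theorem lam_add (p q s : ℤ × ℤ) : lam (p + q) s = lam p s * lam q s := by
  simp only [lam, mono_mul]
  congr 1
  ext
  · simp; ring
  · simp; ring
  · simp; ring

theorem lam_zero (s : ℤ × ℤ) : lam 0 s = 1 := by
  simp [lam, ← mono_zero, ← Prod.mk_zero_zero]

theorem Gen.act_cyl {a b : ℕ} (g : Gen a b) (s : VGen) (x : Word a →₀ R) :
    (Gen.cyl g).act θ (consMap s a x) = θ (lam g.deg s.deg) • consMap s b (g.act θ x) := by
  induction x using Finsupp.induction_linear with
  | zero => simp
  | add x y hx hy => simp [hx, hy]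
  | single w r =>
    have : Finsupp.single w r = r • Finsupp.single w (1 : R) := by simp
    rw [this]
    simp only [map_smul]
    simp [consMap, Gen.act, smul_comm r, Finsupp.mapDomain_single]

theorem Cob.act_cyl {a b : ℕ} (W : Cob a b) (s : VGen) (x : Word a →₀ R) :
    W.cyl.act θ (consMap s a x) = θ (lam W.deg s.deg) • consMap s b (W.act θ x) := by
  induction W with
  | id => simp [Cob.cyl, Cob.act, Cob.deg, lam_zero]
  | snoc W g ih =>
    simp only [Cob.cyl, Cob.act, Cob.deg, LinearMap.comp_apply, ih, map_smul, Gen.act_cyl,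
      lam_add, map_mul, smul_smul]

theorem word_ext {n : ℕ} {M : Type} [AddCommGroup M] [Module R M]
    {f g : (Word (n + 1) →₀ R) →ₗ[R] M}
    (h : ∀ s, f ∘ₗ consMap s n = g ∘ₗ consMap s n) : f = g := by
  refine Finsupp.lhom_ext' fun w => LinearMap.ext_ring ?_
  cases w with
  | cons s w => simpa [consMap, Finsupp.mapDomain_single] using LinearMap.congr_fun (h s) (.single w 1)

theorem Gen.cyls_deg {a b : ℕ} (g : Gen a b) (n : ℕ) : (g.cyls n).deg = g.deg := by
  induction n with
  | zero => rfl
  | succ n ih => exact ih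

theorem Cob.deg_comp {a b c : ℕ} (V : Cob a b) :
    (W : Cob b c) → (V.comp W).deg = V.deg + W.deg
  | .id _ => by simp [Cob.comp, Cob.deg]
  | .snoc W g => by simp [Cob.comp, Cob.deg, V.deg_comp W, add_assoc]

theorem Cob.deg_cyl {a b : ℕ} : (W : Cob a b) → W.cyl.deg = W.deg
  | .id _ => by simp [Cob.cyl, Cob.deg]
  | .snoc W g => by simp [Cob.cyl, Cob.deg, W.deg_cyl, Gen.deg]

theorem ChRel.deg_eq {a b : ℕ} {U V : Cob a b} {c : Coeff} (h : ChRel U c V) :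
    U.deg = V.deg := by
  induction h with
  | cyl h ih => simpa [Cob.deg_cyl] using ih
  | disjoint g h =>
    simp [Cob.deg_comp, Gen.toCob, Cob.deg, Gen.cyls_deg, Gen.deg, add_comm]
  | _ => simp [Cob.deg_comp, Cob.deg_cyl, Gen.toCob, Cob.deg, Gen.deg, Surf.deg]

theorem merge_act (r : ℕ) (s t : VGen) (x : Word r →₀ R) :
    (Gen.elem .merge r).act θ (consMap s _ (consMap t _ x)) =
      match s, t with
      | .plus, .plus => consMap .plus _ x
      | .plus, .minus => consMap .minus _ x
      | .minus, .plus => θ (X * Z) • consMap .minus _ x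
      | .minus, .minus => 0 := by
  induction x using Finsupp.induction_linear with
  | zero => cases s <;> cases t <;> simp
  | add x y hx hy => cases s <;> cases t <;> simp_all
  | single w r =>
    cases s <;> cases t <;> simp [consMap, Gen.act, Surf.act, Finsupp.mapDomain_single, mul_comm, -map_mul]

theorem split_act (r : ℕ) (s : VGen) (x : Word r →₀ R) :
    (Gen.elem .split r).act θ (consMap s _ x) =
      match s with
      | .plus => consMap .minus _ (consMap .plus _ x) +
          θ (Y * Z) • consMap .plus _ (consMap .minus _ x)
      | .minus => consMap .minus _ (consMap .minus _ x) := by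
  induction x using Finsupp.induction_linear with
  | zero => cases s <;> simp
  | add x y hx hy => cases s <;> (simp_all; try abel)
  | single w r =>
    cases s <;> simp [consMap, Gen.act, Surf.act, Finsupp.mapDomain_single, mul_comm, -map_mul]

theorem birth_act (r : ℕ) (x : Word r →₀ R) :
    (Gen.elem .birth r).act θ x = consMap .plus _ x := by
  induction x using Finsupp.induction_linear with
  | zero => simp
  | add x y hx hy => simp_all
  | single w r => simp [consMap, Gen.act, Surf.act, Finsupp.mapDomain_single]

theorem deathPos_act (r : ℕ) (s : VGen) (x : Word r →₀ R) :
    (Gen.elem .deathPos r).act θ (consMap s _ x) =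
      match s with
      | .plus => 0
      | .minus => θ Y • x := by
  induction x using Finsupp.induction_linear with
  | zero => cases s <;> simp
  | add x y hx hy => cases s <;> simp_all
  | single w r =>
    cases s <;> simp [consMap, Gen.act, Surf.act, Finsupp.mapDomain_single, mul_comm]

theorem deathNeg_act (r : ℕ) (s : VGen) (x : Word r →₀ R) :
    (Gen.elem .deathNeg r).act θ (consMap s _ x) =
      match s with
      | .plus => 0
      | .minus => x := by
  induction x using Finsupp.induction_linear with
  | zero => cases s <;> simp
  | add x y hx hy => cases s <;> simp_all
  | single w r =>
    cases s <;> simp [consMap, Gen.act, Surf.act, Finsupp.mapDomain_single]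

theorem twist_act (r : ℕ) (s t : VGen) (x : Word r →₀ R) :
    (Gen.elem .twist r).act θ (consMap s _ (consMap t _ x)) =
      θ (lam s.deg t.deg) • consMap t _ (consMap s _ x) := by
  induction x using Finsupp.induction_linear with
  | zero => simp
  | add x y hx hy => simp_all
  | single w r =>
    simp [consMap, Gen.act, Surf.act, Finsupp.mapDomain_single, mul_comm]

theorem X_eq : (X : Coeff) = mono (1, 0, 0) := rfl
theorem Y_eq : (Y : Coeff) = mono (0, 1, 0) := rfl
theorem Z_eq : (Z : Coeff) = mono (0, 0, 1) := rfl
theorem mono_zero' : mono (0, 0, 0) = 1 := rfl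

set_option linter.unusedSimpArgs false in
set_option maxHeartbeats 2000000 in
/-- The linear maps respect the defining relations. -/
theorem ChRel.act_eq {a b : ℕ} {U V : Cob a b} {c : Coeff} (h : ChRel U c V) :
    U.act θ = θ c • V.act θ := by
  have h2 : (1 : ZMod 2) + 1 = 0 := rfl
  induction h with
  | cyl h ih =>
    refine word_ext fun s => LinearMap.ext fun x => ?_
    simp [Cob.act_cyl, ih, h.deg_eq, smul_comm (θ (lam _ _))]
  | disjoint g h =>
    cases g with
    | merge | twist =>
      refine word_ext fun s => word_ext fun t => LinearMap.ext fun x => ?_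
      cases s <;> cases t <;>
        simp [Cob.act, Cob.comp, Gen.toCob, twist_act, merge_act, VGen.deg, lam, X_eq, Z_eq,
          mono_mul, ← map_mul, smul_smul, h2, Gen.cyls, Gen.act_cyl, Gen.deg, Surf.deg,
          mono_zero', CharTwo.add_self_eq_zero, CharTwo.add_cancel_left, add_comm, add_left_comm, add_assoc]
    | split | deathPos | deathNeg =>
      refine word_ext fun s => LinearMap.ext fun x => ?_
      cases s <;>
        simp [Cob.act, Cob.comp, Gen.toCob, split_act, deathPos_act, deathNeg_act, VGen.deg, lam,
          Y_eq, Z_eq, mono_mul, ← map_mul, smul_smul, h2, Gen.cyls, Gen.act_cyl, Gen.deg, Surf.deg,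
          mono_zero', CharTwo.add_self_eq_zero, CharTwo.add_cancel_left, add_comm, add_left_comm, add_assoc]
    | birth =>
      refine LinearMap.ext fun x => ?_
      simp [Cob.act, Cob.comp, Gen.toCob, birth_act, VGen.deg, lam,
          mono_mul, ← map_mul, smul_smul, h2, Gen.cyls, Gen.act_cyl, Gen.deg, Surf.deg,
          mono_zero', CharTwo.add_self_eq_zero, CharTwo.add_cancel_left, add_comm, add_left_comm, add_assoc]
  | merge_reverse r | twist_twist r =>
    refine word_ext fun s => word_ext fun t => LinearMap.ext fun x => ?_
    cases s <;> cases t <;>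
      simp [Cob.act, Cob.comp, Gen.toCob, twist_act, merge_act, VGen.deg, lam, X_eq, Z_eq,
        mono_mul, ← map_mul, smul_smul, h2, mono_zero']
  | split_reverse r | death_reverse r | birth_merge r | split_deathPos r
  | split_deathNeg r | split_split r | birth_twist r =>
    refine word_ext fun s => LinearMap.ext fun x => ?_
    cases s <;>
      simp [Cob.act, Cob.comp, Gen.toCob, Cob.cyl, Gen.act_cyl, Gen.deg, Surf.deg, twist_act,
        merge_act, split_act, birth_act, deathPos_act, deathNeg_act, VGen.deg, lam, X_eq, Y_eq,
        Z_eq, mono_mul, ← map_mul, smul_smul, h2, mono_zero']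
    all_goals first | rfl | abel
  | split_merge r | split_merge' r | split_twist r | deathPos_twist r | deathNeg_twist r =>
    refine word_ext fun s => word_ext fun t => LinearMap.ext fun x => ?_
    cases s <;> cases t <;>
      simp [Cob.act, Cob.comp, Gen.toCob, Cob.cyl, Gen.act_cyl, Gen.deg, Surf.deg, twist_act,
        merge_act, split_act, deathPos_act, deathNeg_act, VGen.deg, lam, X_eq, Y_eq,
        Z_eq, mono_mul, ← map_mul, smul_smul, h2, mono_zero']
  | merge_merge r | twist_braid r | merge_twist r =>
    refine word_ext fun s => word_ext fun t => word_ext fun u => LinearMap.ext fun x => ?_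
    cases s <;> cases t <;> cases u <;>
      simp [Cob.act, Cob.comp, Gen.toCob, Cob.cyl, Gen.act_cyl, Gen.deg, Surf.deg, twist_act,
        merge_act, VGen.deg, lam, X_eq, Y_eq,
        Z_eq, mono_mul, ← map_mul, smul_smul, h2, mono_zero']

/-- A number of circles goes to a tensor power of `A`, a cobordism to its linear map. -/
def cobFunctor : Circles ⥤ ModuleCat.{0} R where
  obj a := ModuleCat.of R (Word a.num →₀ R)
  map W := ModuleCat.ofHom (Cob.act θ W)
  map_id a := by
    have : Cob.act θ (Cob.id a.num) = LinearMap.id := by rw [Cob.act]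
    exact congrArg ModuleCat.ofHom this
  map_comp V W := by
    rw [← ModuleCat.ofHom_comp]
    exact congrArg _ (Cob.act_comp θ V W)

theorem cobFunctor_relIdeal {a b : Free R Circles} {f : a ⟶ b} (hf : f ∈ relIdeal θ a b) :
    (Free.lift R (cobFunctor θ)).map f = 0 := by
  refine Submodule.span_induction
    (p := fun f _ => (Free.lift R (cobFunctor θ)).map f = 0) ?_ ?_ ?_ ?_ hf
  · rintro _ ⟨m, n, p, U, V, c, q, h, rfl⟩
    have key : (cobFunctor θ).map U = θ c • (cobFunctor θ).map V :=
      congrArg ModuleCat.ofHom (h.act_eq θ)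
    have hU : (Free.lift R (cobFunctor θ)).map ((Free.embedding R Circles).map U) =
        (cobFunctor θ).map U :=
      (Free.lift_map_single R (cobFunctor θ) U 1).trans (one_smul _ _)
    have hV : (Free.lift R (cobFunctor θ)).map ((Free.embedding R Circles).map V) =
        (cobFunctor θ).map V :=
      (Free.lift_map_single R (cobFunctor θ) V 1).trans (one_smul _ _)
    have : (Free.lift R (cobFunctor θ)).map
        ((Free.embedding R Circles).map U - θ c • (Free.embedding R Circles).map V) = 0 := by
      rw [Functor.map_sub, Functor.map_smul, sub_eq_zero]
      exact hU.trans (key.trans (congrArg (θ c • ·) hV.symm))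
    rw [Functor.map_comp, Functor.map_comp, this, zero_comp, comp_zero]
  · exact Functor.map_zero _ _ _
  · intro x y _ _ hx hy
    rw [Functor.map_add, hx, hy, add_zero]
  · intro r x _ hx
    rw [Functor.map_smul, hx, smul_zero]

/-- The chronological TQFT. -/
def tqft : ChCob θ ⥤ ModuleCat.{0} R :=
  CategoryTheory.Quotient.lift _ (Free.lift R (cobFunctor θ)) fun a b f g h => by
    have := cobFunctor_relIdeal θ h
    rwa [Functor.map_sub, sub_eq_zero] at this

instance : (tqft θ).Additive where
  map_add {a b f g} := by
    obtain ⟨f, rfl⟩ := (Quotient.functor _).map_surjective f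
    obtain ⟨g, rfl⟩ := (Quotient.functor _).map_surjective g
    exact (Free.lift R (cobFunctor θ)).map_add

end TQFT

/-! ### Link diagrams and their resolutions -/

/-- At each crossing the four outgoing half-edges are numbered counterclockwise by `0, 1, 2, 3`,
starting with the one along which the lower strand enters the crossing; hence the lower strand
runs from `0` to `2`. At a positive crossing the upper strand runs from `3` to `1`, at a negative
one from `1` to `3`. This says whether the strand enters the crossing along the half-edge. -/
def incoming (positive : Bool) (j : Fin 4) : Bool :=
  match j with
  | 0 => true
  | 1 => !positive
  | 2 => false
  | 3 => positive

/-- An oriented link diagram in the plane. The half-edges at the crossings (numbered as above) are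
joined in pairs, consistently with the orientation, and there are `loops` components without
crossings. Planarity is expressed by the Euler characteristic: the orbits of the permutation
`d ↦ next (glue d)`, where `next` is the counterclockwise rotation at a crossing, are the boundaries
of faces, so that `V - E + F = 2 C` with `E = 2 V`, where `C` is the number of
connected components of the underlying graph. -/
structure LinkDiagram where
  /-- the number of crossings -/
  crossings : ℕ
  /-- the signs of the crossings -/
  positive : Fin crossings → Bool
  /-- the other half of the edge -/
  glue : Fin crossings × Fin 4 → Fin crossings × Fin 4
  glue_glue : ∀ d, glue (glue d) = d
  glue_oriented : ∀ d,
    incoming (positive (glue d).1) (glue d).2 = !incoming (positive d.1) d.2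
  /-- the number of components without crossings -/
  loops : ℕ
  planar : Nat.card (Quot fun d d' => d' = ((glue d).1, (glue d).2 + 1)) =
    crossings + 2 * Nat.card (Quot fun d d' : Fin crossings × Fin 4 => d' = glue d ∨ d'.1 = d.1)

/-- The half-edge joined to `j` inside the resolved crossing: the resolution of type `0` joins
`0` with `1` and `2` with `3`, the one of type `1` joins `0` with `3` and `1` with `2`. -/
def smooth (type : Bool) (j : Fin 4) : Fin 4 :=
  match type, j with
  | false, 0 => 1
  | false, 1 => 0
  | false, 2 => 3
  | false, 3 => 2
  | true, 0 => 3
  | true, 1 => 2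
  | true, 2 => 1
  | true, 3 => 0

namespace LinkDiagram

variable (D : LinkDiagram)

/-- The vertices of the cube of resolutions; `false` and `true` are the types `0` and `1`. -/
abbrev Vertex : Type := Fin D.crossings → Bool

variable {D} in
/-- There is an edge from `ξ` to `ξ'` that changes the resolution of the `i`-th crossing. -/
def IsEdge (i : Fin D.crossings) (ξ ξ' : D.Vertex) : Prop :=
  ξ i = false ∧ ξ' = Function.update ξ i true

variable {D} in
/-- The weight of a vertex. -/
def weight (ξ : D.Vertex) : ℕ := (Finset.univ.filter fun i => ξ i = true).card

/-- The number of negative crossings. -/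
def negative : ℕ := (Finset.univ.filter fun i => D.positive i = false).card

/-- Half-edges and components without crossings. -/
abbrev Piece : Type := Fin D.crossings × Fin 4 ⊕ Fin D.loops

/-- Two pieces are adjacent in a resolution. -/
def Adjacent (ξ : D.Vertex) (p q : D.Piece) : Prop :=
  ∃ d, p = .inl d ∧ (q = .inl (D.glue d) ∨ q = .inl (d.1, smooth (ξ d.1) d.2))

/-- The circles of a resolution. -/
def Circle (ξ : D.Vertex) : Type := Quot (D.Adjacent ξ)

/-- The circle that contains a given piece. -/
def circle (ξ : D.Vertex) (p : D.Piece) : D.Circle ξ := Quot.mk _ p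

end LinkDiagram

/-! ### The cube of resolutions -/

/-- The cobordism that moves the circle in position `p` to the front. -/
def bringFront : (m : ℕ) → Fin (m + 1) → Cob (m + 1) (m + 1)
  | 0, _ => .id 1
  | m + 1, p => Fin.cases (.id (m + 2)) (fun q => (bringFront m q).cyl.comp (twist m)) p

/-- The permutation cobordism, a composition of twists, that puts in position `j` the circle from
position `e j`. -/
def permCob : (m m' : ℕ) → (Fin m' ≃ Fin m) → Cob m m'
  | 0, 0, _ => .id 0
  | m + 1, m' + 1, e => (bringFront m (e 0)).comp
      (permCob m m' (Equiv.removeNone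
        ((finSuccEquiv m').symm.trans (e.trans (finSuccEquiv' (e 0)))))).cyl
  | 0, _ + 1, e => (e 0).elim0
  | _ + 1, 0, e => (e.symm 0).elim0

/-- The permutation cobordism between two orderings of the same circles. -/
def reorder {m m' : ℕ} {α : Type} (a : Fin m ≃ α) (b : Fin m' ≃ α) : Cob m m' :=
  permCob m m' (b.trans a.symm)

/-- A description of the surgery along the arrow at the crossing `i` as a merge or a split.
The arrow joins the two arcs of the type `0` resolution, the one through the half-edges `0`, `1`
and the one through `2`, `3`; it starts at the former if `arrow` holds.
For a merge, `b` is an ordering of the input circles that begins with the circle at the source and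
the circle at the target of the arrow. For a split, `b'` is an ordering of the output circles
that begins with the circle to the right and the circle to the left of the arrow. The other circles
are not changed, and are listed in the same order in `b` and `b'`. -/
inductive Saddle (D : LinkDiagram) (arrow : Bool) (i : Fin D.crossings) (ξ ξ' : D.Vertex) : Type
  | merge (r : ℕ) (b : Fin (r + 2) ≃ D.Circle ξ) (b' : Fin (r + 1) ≃ D.Circle ξ')
      (source : b 0 = D.circle ξ (.inl (i, if arrow then 0 else 2)))
      (target : b 1 = D.circle ξ (.inl (i, if arrow then 2 else 0)))
      (merged : b' 0 = D.circle ξ' (.inl (i, 0)))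
      (rest : ∀ (j : Fin r) (p : D.Piece),
        D.circle ξ p = b j.succ.succ ↔ D.circle ξ' p = b' j.succ)
  | split (r : ℕ) (b : Fin (r + 1) ≃ D.Circle ξ) (b' : Fin (r + 2) ≃ D.Circle ξ')
      (surgered : b 0 = D.circle ξ (.inl (i, 0)))
      (right : b' 0 = D.circle ξ' (.inl (i, if arrow then 1 else 0)))
      (left : b' 1 = D.circle ξ' (.inl (i, if arrow then 0 else 1)))
      (rest : ∀ (j : Fin r) (p : D.Piece),
        D.circle ξ p = b j.succ ↔ D.circle ξ' p = b' j.succ.succ)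

/-- The saddle cobordism, for given orderings `a` and `a'` of the input and the output circles. -/
def Saddle.cob {D : LinkDiagram} {arrow : Bool} {i : Fin D.crossings} {ξ ξ' : D.Vertex}
    {m m' : ℕ} (a : Fin m ≃ D.Circle ξ) (a' : Fin m' ≃ D.Circle ξ') :
    Saddle D arrow i ξ ξ' → Cob m m'
  | .merge r b b' _ _ _ _ => (reorder a b).comp ((GenKh.merge r).comp (reorder b' a'))
  | .split r b b' _ _ _ _ => (reorder a b).comp ((GenKh.split r).comp (reorder b' a'))

/-- The choices made in the construction of the cube of resolutions: arrows over crossings,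
orderings of the circles of each resolution, and decompositions of the saddle cobordisms
into a merge or a split and permutations. -/
structure Decoration (D : LinkDiagram) where
  /-- the direction of the arrow over a crossing -/
  arrow : Fin D.crossings → Bool
  /-- the number of circles of a resolution -/
  size : D.Vertex → ℕ
  /-- the ordering of the circles of a resolution -/
  order : ∀ ξ, Fin (size ξ) ≃ D.Circle ξ
  /-- the decomposition of the saddle cobordism of an edge -/
  saddle : ∀ {i : Fin D.crossings} {ξ ξ' : D.Vertex},
    LinkDiagram.IsEdge i ξ ξ' → Saddle D (arrow i) i ξ ξ'

open LinkDiagram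

/-- A 1-cochain on the cube with values in the units of `R`. -/
abbrev EdgeCochain (D : LinkDiagram) (R : Type) [CommRing R] : Type :=
  ∀ ⦃i : Fin D.crossings⦄ ⦃ξ ξ' : D.Vertex⦄, IsEdge i ξ ξ' → Rˣ

/-- The image of a 1-cochain under a ring homomorphism. -/
def EdgeCochain.map {D : LinkDiagram} {R S : Type} [CommRing R] [CommRing S] (f : R →+* S)
    (ε : EdgeCochain D R) : EdgeCochain D S :=
  fun _ _ _ h => Units.map (f : R →* S) (ε h)

/-- The coboundary of `ε'` is the image of the coboundary of `ε`: on each face,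
`δ ε' = f (δ ε)`, where `δ ε = (ε h₁ * ε h₂) / (ε k₁ * ε k₂)` for the two directed paths
`h₁, h₂` and `k₁, k₂` along the face. -/
def CoboundaryMapsTo {D : LinkDiagram} {R S : Type} [CommRing R] [CommRing S] (f : R →+* S)
    (ε : EdgeCochain D R) (ε' : EdgeCochain D S) : Prop :=
  ∀ ⦃i j : Fin D.crossings⦄ ⦃ξ ξ₁ ξ₂ ξ' : D.Vertex⦄ (h₁ : IsEdge i ξ ξ₁) (h₂ : IsEdge j ξ₁ ξ')
    (k₁ : IsEdge j ξ ξ₂) (k₂ : IsEdge i ξ₂ ξ'),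
    (ε' h₁ * ε' h₂) / (ε' k₁ * ε' k₂) =
      Units.map (f : R →* S) ((ε h₁ * ε h₂) / (ε k₁ * ε k₂))

section Complex

variable {R : Type} [CommRing R] (θ : Coeff →+* R) {D : LinkDiagram} (c : Decoration D)

/-- The saddle cobordism of an edge. -/
def Decoration.cob {i : Fin D.crossings} {ξ ξ' : D.Vertex} (h : IsEdge i ξ ξ') :
    Cob (c.size ξ) (c.size ξ') :=
  (c.saddle h).cob (c.order ξ) (c.order ξ')

/-- A cochain with which the corrected cube anticommutes. -/
def IsSignAssignment (ε : EdgeCochain D R) : Prop :=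
  ∀ ⦃i j : Fin D.crossings⦄ ⦃ξ ξ₁ ξ₂ ξ' : D.Vertex⦄ (h₁ : IsEdge i ξ ξ₁) (h₂ : IsEdge j ξ₁ ξ')
    (k₁ : IsEdge j ξ ξ₂) (k₂ : IsEdge i ξ₂ ξ'),
    ((ε h₁ : R) • ChCob.mk θ (c.cob h₁)) ≫ ((ε h₂ : R) • ChCob.mk θ (c.cob h₂)) +
      ((ε k₁ : R) • ChCob.mk θ (c.cob k₁)) ≫ ((ε k₂ : R) • ChCob.mk θ (c.cob k₂)) = 0

/-- The formal direct sum of the resolutions of weight `q + n₋`. -/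
def khObj (q : ℤ) : Mat_ (ChCob θ) where
  ι := {ξ : D.Vertex // (weight ξ : ℤ) = q + D.negative}
  X ξ := ChCob.circles θ (c.size ξ.1)

open Classical in
/-- The matrix entry of the differential. -/
def khEntry (ε : EdgeCochain D R) (ξ ξ' : D.Vertex) :
    ChCob.circles θ (c.size ξ) ⟶ ChCob.circles θ (c.size ξ') :=
  ∑ i, if h : IsEdge i ξ ξ' then (ε h : R) • ChCob.mk θ (c.cob h) else 0

/-- The differential. -/
def khD (ε : EdgeCochain D R) (q : ℤ) : khObj θ c q ⟶ khObj θ c (q + 1) :=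
  fun ξ ξ' => khEntry θ c ε ξ.1 ξ'.1

theorem LinkDiagram.IsEdge.weight_eq {i : Fin D.crossings} {ξ ξ' : D.Vertex} (h : IsEdge i ξ ξ') :
    weight ξ' = weight ξ + 1 := by
  obtain ⟨h, rfl⟩ := h
  rw [weight, weight, ← Finset.card_insert_of_notMem (a := i) (by simp [h])]
  congr 1
  ext j
  by_cases hj : j = i
  · subst hj; simp
  · simp [hj]

theorem LinkDiagram.IsEdge.swap {i j : Fin D.crossings} {ξ ξ₁ ξ' : D.Vertex} (h₁ : IsEdge i ξ ξ₁)
    (h₂ : IsEdge j ξ₁ ξ') : i ≠ j ∧ ∃ ξ₂, IsEdge j ξ ξ₂ ∧ IsEdge i ξ₂ ξ' := by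
  obtain ⟨h, rfl⟩ := h₁
  obtain ⟨h', rfl⟩ := h₂
  have hij : j ≠ i := by rintro rfl; simp at h'
  rw [Function.update_of_ne hij] at h'
  exact ⟨hij.symm, _, ⟨h', rfl⟩, by rwa [Function.update_of_ne hij.symm],
    Function.update_comm hij.symm _ _ _⟩

open Classical in
theorem khD_comp_khD {ε : EdgeCochain D R} (hε : IsSignAssignment θ c ε) (q : ℤ) :
    khD θ c ε q ≫ khD θ c ε (q + 1) = 0 := by
  refine Mat_.hom_ext _ _ fun ξ ξ' => ?_
  let A : ∀ (i : Fin D.crossings) (ξ ξ' : D.Vertex),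
      ChCob.circles θ (c.size ξ) ⟶ ChCob.circles θ (c.size ξ') := fun i ξ ξ' =>
    if h : IsEdge i ξ ξ' then (ε h : R) • ChCob.mk θ (c.cob h) else 0
  let T : Fin D.crossings × Fin D.crossings →
      (ChCob.circles θ (c.size ξ.1) ⟶ ChCob.circles θ (c.size ξ'.1)) := fun p =>
    ∑ η : (khObj θ c (q + 1)).ι, A p.1 ξ.1 η.1 ≫ A p.2 η.1 ξ'.1
  have hT : ∀ {i j : Fin D.crossings} {η : D.Vertex} (h₁ : IsEdge i ξ.1 η)
      (h₂ : IsEdge j η ξ'.1), T (i, j) =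
        ((ε h₁ : R) • ChCob.mk θ (c.cob h₁)) ≫ ((ε h₂ : R) • ChCob.mk θ (c.cob h₂)) := by
    intro i j η h₁ h₂
    have hη : (weight η : ℤ) = q + 1 + D.negative := by
      have := ξ.2
      rw [h₁.weight_eq]; push_cast; lia
    refine (Finset.sum_eq_single (⟨η, hη⟩ : (khObj θ c (q + 1)).ι) ?_ ?_).trans ?_
    · rintro ⟨η', _⟩ _ hne
      have : ¬ IsEdge i ξ.1 η' := fun h => hne (Subtype.ext (h.2.trans h₁.2.symm))
      simp [A, this]
    · exact fun h => absurd (Finset.mem_univ _) h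
    · simp only [A, dif_pos h₁, dif_pos h₂]
  have hT0 : ∀ {i j : Fin D.crossings},
      (∀ η, IsEdge i ξ.1 η → ¬ IsEdge j η ξ'.1) → T (i, j) = 0 := by
    intro i j h
    refine Finset.sum_eq_zero fun η _ => ?_
    by_cases h₁ : IsEdge i ξ.1 η.1
    · simp [A, h _ h₁]
    · simp [A, h₁]
  have hTT : ∀ p, T p + T p.swap = 0 := by
    rintro ⟨i, j⟩
    by_cases h : ∃ η, IsEdge i ξ.1 η ∧ IsEdge j η ξ'.1
    · obtain ⟨η, h₁, h₂⟩ := h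
      obtain ⟨-, η', k₁, k₂⟩ := h₁.swap h₂
      rw [Prod.swap, hT h₁ h₂, hT k₁ k₂]
      exact hε h₁ h₂ k₁ k₂
    · push Not at h
      rw [Prod.swap, hT0 h, hT0, add_zero]
      intro η k₁ k₂
      obtain ⟨-, η', h₁, h₂⟩ := k₁.swap k₂
      exact h _ h₁ h₂
  have hTne : ∀ p, T p ≠ 0 → p.swap ≠ p := by
    rintro ⟨i, j⟩ hp h
    obtain rfl : j = i := congrArg Prod.fst h
    exact hp (hT0 fun η h₁ h₂ => (h₁.swap h₂).1 rfl)
  have hsum : ∑ p, T p = 0 :=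
    Finset.sum_involution (fun p _ => p.swap) (fun p _ => hTT p) (fun p _ => hTne p)
      (fun _ _ => Finset.mem_univ _) (fun _ _ => Prod.swap_swap _)
  refine Eq.trans ?_ hsum
  refine (Mat_.comp_apply (khD θ c ε q) (khD θ c ε (q + 1)) ξ ξ').trans ?_
  calc ∑ η : (khObj θ c (q + 1)).ι, khEntry θ c ε ξ.1 η.1 ≫ khEntry θ c ε η.1 ξ'.1
    _ = ∑ η : (khObj θ c (q + 1)).ι, ∑ i, ∑ j, A i ξ.1 η.1 ≫ A j η.1 ξ'.1 := by
        refine Finset.sum_congr rfl fun η _ => ?_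
        rw [khEntry, khEntry, Preadditive.sum_comp]
        exact Finset.sum_congr rfl fun i _ => Preadditive.comp_sum _ _ _
    _ = ∑ i, ∑ η : (khObj θ c (q + 1)).ι, ∑ j, A i ξ.1 η.1 ≫ A j η.1 ξ'.1 := Finset.sum_comm
    _ = ∑ i, ∑ j, ∑ η : (khObj θ c (q + 1)).ι, A i ξ.1 η.1 ≫ A j η.1 ξ'.1 :=
        Finset.sum_congr rfl fun i _ => Finset.sum_comm
    _ = ∑ p, T p := (Fintype.sum_prod_type T).symm

/-- The generalized Khovanov complex of a link diagram. -/
def kh {ε : EdgeCochain D R} (hε : IsSignAssignment θ c ε) :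
    CochainComplex (Mat_ (ChCob θ)) ℤ :=
  CochainComplex.of (khObj θ c) (khD θ c ε) (khD_comp_khD θ c hε)

/-- The complex of modules obtained by applying the chronological TQFT. -/
def khModule {ε : EdgeCochain D R} (hε : IsSignAssignment θ c ε) :
    CochainComplex (ModuleCat.{0} R) ℤ :=
  ((Mat_.lift (tqft θ)).mapHomologicalComplex _).obj (kh θ c hε)

/-- The generator of the complex of modules given by a generator of the tensor power of `A`
associated to a vertex. -/
def khGen {ε : EdgeCochain D R} (hε : IsSignAssignment θ c ε) {q : ℤ} {ξ : D.Vertex}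
    (hξ : (weight ξ : ℤ) = q + D.negative) (u : Word (c.size ξ)) :
    (khModule θ c hε).X q :=
  (biproduct.ι (fun ξ' : (khObj θ c q).ι => (tqft θ).obj ((khObj θ c q).X ξ')) ⟨ξ, hξ⟩).hom
    (show (tqft θ).obj (ChCob.circles θ (c.size ξ)) from
      (Finsupp.single u 1 : Word (c.size ξ) →₀ R))

end Complex

/-! ### The splitting degree of generators of the complex -/

/-- Directed paths in the cube that start at the initial vertex. -/
inductive CubePath (D : LinkDiagram) : D.Vertex → Type
  | nil : CubePath D fun _ => false
  | snoc {i : Fin D.crossings} {ξ ξ' : D.Vertex} (P : CubePath D ξ) (h : IsEdge i ξ ξ') :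
      CubePath D ξ'

/-- The splitting degree of the cobordism encoded by a path in the corrected cube. -/
def CubePath.sdeg {D : LinkDiagram} (c : Decoration D) (ε : EdgeCochain D Coeff) :
    {ξ : D.Vertex} → CubePath D ξ → SDeg
  | _, .nil => 0
  | _, .snoc P h => P.sdeg c ε + (sdegScalar (ε h) + (c.cob h).sdeg)

/-- The splitting degree of a generator `u` of the complex: the resolution at the vertex `ξ` is
shifted, so that the differential preserves degrees, by the degree of the cobordism encoded by
a path to `ξ`. -/
def genSDeg {D : LinkDiagram} (c : Decoration D) (ε : EdgeCochain D Coeff) {ξ : D.Vertex}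
    (P : CubePath D ξ) (u : Word (c.size ξ)) : SDeg :=
  u.sdeg - P.sdeg c ε

/-- The unit `(φ(X) / X) ^ a * (φ(Z) / Z) ^ b`. The base of the first power is an involution,
so that the power makes sense for a residue `a` modulo `2`. -/
def rescaling (φ : Coeff ≃+* Coeff) (d : SDeg) : Coeffˣ :=
  (Units.map (φ : Coeff →* Coeff) X / X) ^ d.1.val *
    (Units.map (φ : Coeff →* Coeff) Z / Z) ^ d.2

end GenKh

end

open CategoryTheory CategoryTheory.Limits

noncomputable section

namespace GenKh

open LinkDiagram

/-! Write $\rho(a,b)=(\varphi(X)/X)^a(\varphi(Z)/Z)^b$ (`rescaling`). The automorphism $\varphi$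
acts on each homogeneous part of $k$ as multiplication by a unit: if $x$ has degree $d$, then
$\varphi(x)=\rho(d)x$ (`map_eq_rescaling_mul`). Indeed $\varphi(XY)=XY$ makes $X$ and $Y$ scale by
the same involution, and $\varphi(Z)/Z$ is an involution too, because $\varphi(Z)$ is a unit of the
same degree as $Z$ and units are monomials up to sign (`eq_mono_of_isUnit`). Thus $\rho$ is a
homomorphism from degrees to units with $\rho(-d)=\rho(d)$.

The TQFT is homogeneous: the entry of $\mathcal F(W)$ from $u$ to $u'$ has degree
$\mathrm{sdeg}\,u+\mathrm{sdeg}\,W-\mathrm{sdeg}\,u'$ (`Cob.act_isHomog`), and the corresponding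
entry of $\mathcal F_\varphi(W)$ is its image under $\varphi$ (`Cob.act_single_apply`). Hence the
diagonal rescaling $u\mapsto\rho(\mathrm{sdeg}\,u)u$ intertwines $\mathcal F(W)$ and $\mathcal
F_\varphi(W)$ up to the factor $\rho(\mathrm{sdeg}\,W)$.

For the differentials the remaining discrepancy on an edge $\zeta$ is
$\epsilon'(\zeta)/\epsilon(\zeta)\cdot\rho(\mathrm{sdeg}\,D_\zeta)$ (`comparison`). If this cochain
is closed, its product along paths depends only on the endpoint (`EdgeCochain.IsClosed.prod_eq`),
and multiplying by these products absorbs the discrepancy. Since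
$\delta\epsilon'=\varphi(\delta\epsilon)$, closedness reduces to the two paths around a face having
equal splitting degree (`IsSignAssignment.sdeg_eq`). The linear maps of the two paths are opposite
and homogeneous, so their degrees agree once the maps are nonzero. For nonvanishing, put $X=Y=Z=1$:
all matrix entries become nonnegative, so nothing can cancel, and a merge kills only generators with
two factors $v_-$ (`Decoration.exists_act_ne_zero`).

For $\epsilon'=\varphi(\epsilon)$ the product along a path is $\rho$ of its splitting degree, which
gives the explicit formula. -/

/-! ### Units and homogeneous elements of the coefficient ring -/

/-- The units of the ring of Laurent polynomials over the integers. -/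
theorem laurent_eq_of_isUnit {f : LaurentPolynomial ℤ} (hf : IsUnit f) :
    ∃ (s k : ℤ), s ^ 2 = 1 ∧ f = LaurentPolynomial.C s * LaurentPolynomial.T k := by
  obtain ⟨g, hg⟩ := hf.exists_right_inv
  obtain ⟨n, P, hP⟩ := LaurentPolynomial.exists_T_pow f
  obtain ⟨m, Q, hQ⟩ := LaurentPolynomial.exists_T_pow g
  -- After clearing denominators the unit divides a power of the prime $T$ in $\mathbb Z[T]$, so it
  -- is a constant unit times a power of $T$.
  have hPQ : P * Q = Polynomial.X ^ (n + m) := by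
    apply Polynomial.toLaurent_injective
    rw [map_mul, hP, hQ, Polynomial.toLaurent_X_pow]
    push_cast
    rw [LaurentPolynomial.T_add]
    calc _ = (f * g) * (LaurentPolynomial.T n * LaurentPolynomial.T m) := by ring
      _ = _ := by rw [hg, one_mul]
  obtain ⟨i, -, hi⟩ := (dvd_prime_pow (Polynomial.prime_X (R := ℤ)) (n + m)).1 (Dvd.intro _ hPQ)
  obtain ⟨u, hu⟩ := hi.symm
  obtain ⟨s, hs, hsu⟩ := Polynomial.isUnit_iff.1 u.isUnit
  refine ⟨s, i - n, ?_, ?_⟩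
  · rcases Int.isUnit_iff.1 hs with rfl | rfl <;> rfl
  · have : f = Polynomial.toLaurent P * LaurentPolynomial.T (-n) := by
      rw [hP, mul_assoc, ← LaurentPolynomial.T_add, add_neg_cancel, LaurentPolynomial.T_zero,
        mul_one]
    rw [this, ← hu, ← hsu, mul_comm _ (Polynomial.C s), Polynomial.toLaurent_C_mul_X_pow,
      mul_assoc, ← LaurentPolynomial.T_add, sub_eq_add_neg]

theorem coeff_C_mul_T (s k l : ℤ) :
    (LaurentPolynomial.C s * LaurentPolynomial.T k).coeff l = if k = l then s else 0 := by
  rw [← LaurentPolynomial.single_eq_C_mul_T]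
  exact Finsupp.single_apply

theorem zmod_two_cases (a : ZMod 2) : a = 0 ∨ a = 1 := by
  revert a; decide

/-- The nontrivial character of `ZMod 2` with values in the integers. -/
def parity (x : ZMod 2) : ℤ := if x = 0 then 1 else -1

theorem parity_add (x y : ZMod 2) : parity (x + y) = parity x * parity y := by
  revert x y; decide

/-- The homomorphism that sends `X` and `Y` to the signs determined by `p`. -/
def signEval (p : ZMod 2 × ZMod 2) : Coeff →ₐ[ℤ] LaurentPolynomial ℤ :=
  AddMonoidAlgebra.lift ℤ (LaurentPolynomial ℤ) (ZMod 2 × ZMod 2 × ℤ)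
    { toFun := fun m => LaurentPolynomial.C (parity (p.1 * m.toAdd.1 + p.2 * m.toAdd.2.1)) *
        LaurentPolynomial.T m.toAdd.2.2
      map_one' := by simp [parity]
      map_mul' := fun m m' => by
        have : p.1 * (m.toAdd.1 + m'.toAdd.1) + p.2 * (m.toAdd.2.1 + m'.toAdd.2.1) =
          (p.1 * m.toAdd.1 + p.2 * m.toAdd.2.1) + (p.1 * m'.toAdd.1 + p.2 * m'.toAdd.2.1) := by
          ring
        simp only [toAdd_mul, Prod.fst_add, Prod.snd_add, this, parity_add,
          LaurentPolynomial.T_add, map_mul]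
        ring }

/-- In the exponents of $X$ and $Y$ this is the Fourier transform on $(\mathbb Z/2)^2$: the four
choices of `p` run through its characters. -/
theorem coeff_signEval (p : ZMod 2 × ZMod 2) (c : Coeff) (k : ℤ) :
    (signEval p c).coeff k = c.coeff (0, 0, k) + parity p.2 * c.coeff (0, 1, k) +
      parity p.1 * c.coeff (1, 0, k) + parity (p.1 + p.2) * c.coeff (1, 1, k) := by
  induction c using AddMonoidAlgebra.induction_linear with
  | zero => simp
  | add x y hx hy => simp only [map_add, AddMonoidAlgebra.coeff_add, Finsupp.add_apply, hx, hy]; ring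
  | single m r =>
    obtain ⟨a, b, l⟩ := m
    obtain ⟨p, q⟩ := p
    have hp0 : parity 0 = 1 := rfl
    have h : signEval (p, q) (AddMonoidAlgebra.single (a, b, l) r) =
        LaurentPolynomial.C (r * parity (p * a + q * b)) * LaurentPolynomial.T l := by
      rw [signEval, AddMonoidAlgebra.lift_single, LaurentPolynomial.smul_eq_C_mul, map_mul,
        mul_assoc]
      rfl
    rw [h, coeff_C_mul_T]
    by_cases hl : l = k
    · subst hl
      obtain rfl | rfl := zmod_two_cases a <;> obtain rfl | rfl := zmod_two_cases b <;>
        simp [hp0, mul_comm]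
    · simp [hl]

theorem sum_four_sq_eq_one {a b c d : ℤ} (h : a ^ 2 + b ^ 2 + c ^ 2 + d ^ 2 = 1) :
    (a ^ 2 = 1 ∧ b = 0 ∧ c = 0 ∧ d = 0) ∨ (a = 0 ∧ b ^ 2 = 1 ∧ c = 0 ∧ d = 0) ∨
      (a = 0 ∧ b = 0 ∧ c ^ 2 = 1 ∧ d = 0) ∨ (a = 0 ∧ b = 0 ∧ c = 0 ∧ d ^ 2 = 1) := by
  have key : ∀ x : ℤ, x = 0 ∨ 1 ≤ x ^ 2 := fun x => by
    by_cases hx : x = 0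
    · exact .inl hx
    · exact .inr (by have := sq_nonneg x; have := pow_ne_zero 2 hx; omega)
  have := sq_nonneg a; have := sq_nonneg b; have := sq_nonneg c; have := sq_nonneg d
  rcases key a with rfl | ha <;> rcases key b with rfl | hb <;> rcases key c with rfl | hc <;>
    rcases key d with rfl | hd <;> omega

/-- Every unit of the coefficient ring is a monomial up to sign. -/
theorem eq_mono_of_isUnit {c : Coeff} (hc : IsUnit c) : ∃ m, c = mono m ∨ c = -mono m := by
  have H := fun p : ZMod 2 × ZMod 2 => laurent_eq_of_isUnit (hc.map (signEval p))
  choose s k hs hk using H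
  have hcoeff : ∀ p l, (signEval p c).coeff l ^ 2 = if k p = l then 1 else 0 := by
    intro p l
    rw [hk p, coeff_C_mul_T]
    by_cases h : k p = l <;> simp only [h, if_true, if_false, hs] ; rfl
  -- Parseval's identity for $(\mathbb Z/2)^2$ in each $Z$-degree `l`; each evaluation `p` is $\pm
  -- T^{k(p)}$ and contributes 1 exactly when `k p = l`.
  have hsq : ∀ l, 4 * (c.coeff (0, 0, l) ^ 2 + c.coeff (0, 1, l) ^ 2 + c.coeff (1, 0, l) ^ 2 +
      c.coeff (1, 1, l) ^ 2) = (if k (0, 0) = l then 1 else 0) + (if k (0, 1) = l then 1 else 0) +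
        (if k (1, 0) = l then 1 else 0) + (if k (1, 1) = l then 1 else 0) := by
    intro l
    rw [← hcoeff, ← hcoeff, ← hcoeff, ← hcoeff]
    have h0 : parity 0 = 1 := rfl
    have h1 : parity 1 = -1 := rfl
    have h2 : (1 : ZMod 2) + 1 = 0 := rfl
    simp only [coeff_signEval, h0, h1, h2, add_zero, zero_add]
    ring
  have h00 := hsq (k (0, 0))
  simp only [if_true] at h00
  -- At `l = k (0, 0)` the right side lies between 1 and 4 and is divisible by 4, so all four
  -- evaluations have the same exponent.
  obtain ⟨e1, e2, e3⟩ : k (0, 1) = k (0, 0) ∧ k (1, 0) = k (0, 0) ∧ k (1, 1) = k (0, 0) := by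
    by_contra hne
    split_ifs at h00 <;> omega
  rw [if_pos e1, if_pos e2, if_pos e3] at h00
  have hone := sum_four_sq_eq_one (by linarith : c.coeff (0, 0, k (0, 0)) ^ 2 +
    c.coeff (0, 1, k (0, 0)) ^ 2 + c.coeff (1, 0, k (0, 0)) ^ 2 + c.coeff (1, 1, k (0, 0)) ^ 2 = 1)
  have hzero : ∀ l, l ≠ k (0, 0) → ∀ x y, c.coeff (x, y, l) = 0 := by
    intro l hl
    have := hsq l
    rw [e1, e2, e3, if_neg hl.symm] at this
    have h1 := sq_nonneg (c.coeff (0, 0, l)); have h2 := sq_nonneg (c.coeff (0, 1, l))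
    have h3 := sq_nonneg (c.coeff (1, 0, l)); have h4 := sq_nonneg (c.coeff (1, 1, l))
    intro x y
    refine pow_eq_zero_iff two_ne_zero |>.1 ?_
    obtain rfl | rfl := zmod_two_cases x <;> obtain rfl | rfl := zmod_two_cases y <;> linarith
  have finish : ∀ m : ZMod 2 × ZMod 2 × ℤ, c.coeff m ^ 2 = 1 →
      (∀ m', m' ≠ m → c.coeff m' = 0) → ∃ m, c = mono m ∨ c = -mono m := by
    intro m hm hm'
    refine ⟨m, (sq_eq_one_iff.1 hm).imp (fun h => ?_) (fun h => ?_)⟩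
    all_goals
      refine AddMonoidAlgebra.coeff_injective (Finsupp.ext fun m' => ?_)
      by_cases hmm : m' = m
      · subst hmm; simp [mono, h]
      · simp [mono, hm' _ hmm, Ne.symm hmm]
  have far : ∀ x y : ZMod 2, (∀ x' y', (x', y') ≠ (x, y) → c.coeff (x', y', k (0, 0)) = 0) →
      ∀ m', m' ≠ (x, y, k (0, 0)) → c.coeff m' = 0 := by
    rintro x y h ⟨x', y', l⟩ hne
    by_cases hl : l = k (0, 0)
    · subst hl
      exact h x' y' (by simpa using hne)
    · exact hzero l hl x' y'
  rcases hone with h | h | h | h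
  · refine finish (0, 0, k (0, 0)) h.1 (far _ _ fun x y hxy => ?_)
    obtain rfl | rfl := zmod_two_cases x <;> obtain rfl | rfl := zmod_two_cases y <;>
      first | exact absurd rfl hxy | exact h.2.1 | exact h.2.2.1 | exact h.2.2.2
  · refine finish (0, 1, k (0, 0)) h.2.1 (far _ _ fun x y hxy => ?_)
    obtain rfl | rfl := zmod_two_cases x <;> obtain rfl | rfl := zmod_two_cases y <;>
      first | exact absurd rfl hxy | exact h.1 | exact h.2.2.1 | exact h.2.2.2
  · refine finish (1, 0, k (0, 0)) h.2.2.1 (far _ _ fun x y hxy => ?_)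
    obtain rfl | rfl := zmod_two_cases x <;> obtain rfl | rfl := zmod_two_cases y <;>
      first | exact absurd rfl hxy | exact h.1 | exact h.2.1 | exact h.2.2.2
  · refine finish (1, 1, k (0, 0)) h.2.2.2 (far _ _ fun x y hxy => ?_)
    obtain rfl | rfl := zmod_two_cases x <;> obtain rfl | rfl := zmod_two_cases y <;>
      first | exact absurd rfl hxy | exact h.1 | exact h.2.1 | exact h.2.2.1

theorem mono_mem_coeffGrade (m : ZMod 2 × ZMod 2 × ℤ) :
    mono m ∈ coeffGrade (m.1 + m.2.1, -m.2.2) :=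
  AddMonoidAlgebra.single_mem_gradeBy (fun m : ZMod 2 × ZMod 2 × ℤ => (m.1 + m.2.1, -m.2.2)) m 1

theorem mono_mem_coeffGrade_of_eq {m : ZMod 2 × ZMod 2 × ℤ} {d : SDeg}
    (h : (m.1 + m.2.1, -m.2.2) = d) : mono m ∈ coeffGrade d :=
  h ▸ mono_mem_coeffGrade m

/-- The splitting degree of monomials. -/
def monoSDeg : ZMod 2 × ZMod 2 × ℤ →+ SDeg where
  toFun m := (m.1 + m.2.1, -m.2.2)
  map_zero' := by simp
  map_add' m m' := by
    ext
    · simp only [Prod.fst_add, Prod.snd_add]; ring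
    · simp only [Prod.snd_add]; ring

theorem mul_mem_coeffGrade {x y : Coeff} {d e : SDeg} (hx : x ∈ coeffGrade d)
    (hy : y ∈ coeffGrade e) : x * y ∈ coeffGrade (d + e) :=
  (AddMonoidAlgebra.gradeBy.gradedMonoid (R := ℤ) monoSDeg).mul_mem hx hy

theorem coeffGrade_unique {x : Coeff} {d e : SDeg} (hx : x ∈ coeffGrade d)
    (hy : x ∈ coeffGrade e) (h : x ≠ 0) : d = e := by
  have : x.coeff ≠ 0 := fun h0 => h (AddMonoidAlgebra.coeff_injective h0)
  obtain ⟨m, hm⟩ := Finsupp.support_nonempty_iff.2 this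
  exact (hx m hm).symm.trans (hy m hm)

/-- `sdegScalar` is meaningful only where its defining choice has a solution; units have one, being
monomials up to sign. -/
theorem mem_coeffGrade_sdegScalar (c : Coeffˣ) : (c : Coeff) ∈ coeffGrade (sdegScalar c) := by
  refine Classical.epsilon_spec (p := fun d => (c : Coeff) ∈ coeffGrade d) ?_
  obtain ⟨m, h | h⟩ := eq_mono_of_isUnit c.isUnit
  · exact ⟨_, h ▸ mono_mem_coeffGrade m⟩
  · exact ⟨_, h ▸ neg_mem (mono_mem_coeffGrade m)⟩

/-- A product of monomials in the parameters. -/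
theorem monoUnit_eq (m : ZMod 2 × ZMod 2 × ℤ) :
    monoUnit m = X ^ m.1.val * Y ^ m.2.1.val * Z ^ m.2.2 := by
  have hadd : ∀ m m', monoUnit m * monoUnit m' = monoUnit (m + m') :=
    fun m m' => Units.ext (mono_mul m m')
  let f : Multiplicative (ZMod 2 × ZMod 2 × ℤ) →* Coeffˣ :=
    { toFun := fun m => monoUnit m.toAdd
      map_one' := Units.ext mono_zero
      map_mul' := fun m m' => (hadd _ _).symm }
  have hZ : ∀ k : ℤ, Z ^ k = monoUnit (0, 0, k) := fun k => by
    have := map_zpow f (.ofAdd (0, 0, 1)) k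
    rw [← ofAdd_zsmul] at this
    simp at this
    exact this.symm
  have hX : ∀ a : ZMod 2, X ^ a.val = monoUnit (a, 0, 0) := fun a => by
    have := map_pow f (.ofAdd (1, 0, 0)) a.val
    rw [← ofAdd_nsmul] at this
    simp at this
    exact this.symm
  have hY : ∀ a : ZMod 2, Y ^ a.val = monoUnit (0, a, 0) := fun a => by
    have := map_pow f (.ofAdd (0, 1, 0)) a.val
    rw [← ofAdd_nsmul] at this
    simp at this
    exact this.symm
  rw [hX, hY, hZ, hadd, hadd]
  simp

theorem X_sq : X ^ 2 = 1 := Units.ext (by simp [X, monoUnit, sq, mono_mul]; rfl)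

/-- The representative `ZMod.val` fails to be additive only at $1+1$, where $g^2=1$ compensates. -/
theorem pow_val_add {G : Type} [CommGroup G] {g : G} (hg : g ^ 2 = 1) (a b : ZMod 2) :
    g ^ (a + b).val = g ^ a.val * g ^ b.val := by
  obtain rfl | rfl := zmod_two_cases a <;> obtain rfl | rfl := zmod_two_cases b
  · simp
  · simp
  · simp
  · change g ^ 0 = g ^ 1 * g ^ 1
    rw [← pow_add, hg, pow_zero]

/-! ### The action of $\varphi$ on homogeneous elements. -/

section Rescaling

variable {φ : Coeff ≃+* Coeff}

theorem map_X_div_X_sq : (Units.map (φ : Coeff →* Coeff) X / X) ^ 2 = 1 := by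
  rw [div_pow, ← map_pow, X_sq, map_one, div_one]

/-- The unit $\varphi(Z)$ equals $\pm X^aY^bZ^k$, and its degree forces $k=1$. Squaring removes the
sign and the powers of $X$ and $Y$, leaving $Z^2$. -/
theorem map_Z_div_Z_sq
    (hφ : ∀ (d : SDeg) (x : Coeff), x ∈ coeffGrade d → φ x ∈ coeffGrade d) :
    (Units.map (φ : Coeff →* Coeff) Z / Z) ^ 2 = 1 := by
  have hZ : (Z : Coeff) ∈ coeffGrade (0, -1) := mono_mem_coeffGrade (0, 0, 1)
  obtain ⟨⟨a, b, k⟩, h⟩ := eq_mono_of_isUnit (Units.map (φ : Coeff →* Coeff) Z).isUnit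
  have hmem : mono (a, b, k) ∈ coeffGrade (0, -1) := by
    have h' := hφ _ _ hZ
    rcases h with h | h
    · exact h ▸ h'
    · rw [← neg_neg (mono _), ← h]
      exact neg_mem h'
  have hne : mono (a, b, k) ≠ 0 := (monoUnit (a, b, k)).ne_zero
  have hd := coeffGrade_unique (mono_mem_coeffGrade (a, b, k)) hmem hne
  obtain rfl : k = 1 := by simpa using congrArg Prod.snd hd
  rw [div_pow, div_eq_one]
  refine Units.ext ?_
  have hsq : ((Units.map (φ : Coeff →* Coeff) Z : Coeffˣ) : Coeff) ^ 2 = mono (a, b, 1) ^ 2 := by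
    rcases h with h | h <;> rw [h]
    exact neg_sq _
  rw [Units.val_pow_eq_pow_val, Units.val_pow_eq_pow_val, hsq, Z_eq, sq, sq, mono_mul, mono_mul]
  congr 1
  ext <;> simp [CharTwo.add_self_eq_zero]

/-- The hypothesis on $XY$ enters here. Since $X$ and $Y$ have the same degree, a scaling factor
that depends on the degree alone has to agree on them. Their factors are inverse to each other, and
the one of $X$ is an involution. -/
theorem map_Y_div_Y (hXY : φ (X * Y) = X * Y) :
    Units.map (φ : Coeff →* Coeff) Y / Y = Units.map (φ : Coeff →* Coeff) X / X := by
  have h : Units.map (φ : Coeff →* Coeff) (X * Y) = X * Y := Units.ext hXY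
  have h1 : (Units.map (φ : Coeff →* Coeff) X / X) * (Units.map (φ : Coeff →* Coeff) Y / Y) = 1 := by
    rw [div_mul_div_comm, ← map_mul, h, div_self']
  have h2 := map_X_div_X_sq (φ := φ)
  rw [sq] at h2
  exact mul_left_cancel (h1.trans h2.symm)

theorem rescaling_add (d e : SDeg) :
    rescaling φ (d + e) = rescaling φ d * rescaling φ e := by
  rw [rescaling, rescaling, rescaling, Prod.fst_add, Prod.snd_add, pow_val_add map_X_div_X_sq,
    zpow_add]
  exact mul_mul_mul_comm _ _ _ _

theorem rescaling_zero : rescaling φ 0 = 1 := by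
  simp [rescaling]

/-- The rescaling factors are involutions. -/
theorem rescaling_neg (hφ : ∀ (d : SDeg) (x : Coeff), x ∈ coeffGrade d → φ x ∈ coeffGrade d)
    (d : SDeg) : rescaling φ (-d) = rescaling φ d := by
  have h := map_Z_div_Z_sq hφ
  rw [rescaling, rescaling, Prod.fst_neg, Prod.snd_neg, ZMod.neg_eq_self_mod_two, zpow_neg,
    ← inv_zpow, inv_eq_of_mul_eq_one_left (by rwa [← sq])]

theorem map_mono (hφ : ∀ (d : SDeg) (x : Coeff), x ∈ coeffGrade d → φ x ∈ coeffGrade d)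
    (hXY : φ (X * Y) = X * Y) (m : ZMod 2 × ZMod 2 × ℤ) :
    φ (mono m) = rescaling φ (m.1 + m.2.1, -m.2.2) * mono m := by
  have h : Units.map (φ : Coeff →* Coeff) (monoUnit m) =
      rescaling φ (-(m.1 + m.2.1, -m.2.2)) * monoUnit m := by
    rw [← div_eq_iff_eq_mul, monoUnit_eq, map_mul, map_mul, map_pow, map_pow, map_zpow,
      mul_div_mul_comm, mul_div_mul_comm, ← div_pow, ← div_pow, ← div_zpow, map_Y_div_Y hXY,
      rescaling, Prod.fst_neg, Prod.snd_neg, ZMod.neg_eq_self_mod_two, neg_neg,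
      pow_val_add map_X_div_X_sq]
  -- As $Z$ has degree $(0,-1)$, the exponent of $\varphi(Z)/Z$ comes out as minus the second
  -- component of the degree. The sign is immaterial for an involution.
  rw [rescaling_neg hφ] at h
  exact congrArg Units.val h

/-- A graded automorphism that fixes `XY` rescales homogeneous elements. -/
theorem map_eq_rescaling_mul
    (hφ : ∀ (d : SDeg) (x : Coeff), x ∈ coeffGrade d → φ x ∈ coeffGrade d)
    (hXY : φ (X * Y) = X * Y) {d : SDeg} {x : Coeff} (hx : x ∈ coeffGrade d) :
    φ x = rescaling φ d * x := by
  rw [← AddMonoidAlgebra.sum_coeff_single x, Finsupp.sum, map_sum, Finset.mul_sum]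
  refine Finset.sum_congr rfl fun m hm => ?_
  have h : AddMonoidAlgebra.single m (x.coeff m) = x.coeff m • mono m := by
    simp [mono]
  rw [h, map_zsmul, map_mono hφ hXY, show (m.1 + m.2.1, -m.2.2) = d from hx m hm,
    mul_smul_comm]

end Rescaling

/-! ### Change of parameters in the linear maps of cobordisms -/

section Map

variable {R : Type} [CommRing R] (θ : Coeff →+* R)

/-- Applying a ring homomorphism to all coefficients. -/
def mapCoeff (n : ℕ) : (Word n →₀ Coeff) →+ (Word n →₀ R) :=
  Finsupp.mapRange.addMonoidHom (θ : Coeff →+ R)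

theorem mapCoeff_apply {n : ℕ} (x : Word n →₀ Coeff) (w : Word n) :
    mapCoeff θ n x w = θ (x w) := by
  simp [mapCoeff]

theorem mapCoeff_single {n : ℕ} (w : Word n) (c : Coeff) :
    mapCoeff θ n (.single w c) = .single w (θ c) := by
  simp [mapCoeff]

theorem mapCoeff_smul {n : ℕ} (c : Coeff) (x : Word n →₀ Coeff) :
    mapCoeff θ n (c • x) = θ c • mapCoeff θ n x := by
  ext w; simp [mapCoeff_apply]

theorem mapCoeff_consMap {n : ℕ} (s : VGen) (x : Word n →₀ Coeff) :
    mapCoeff θ _ (consMap s n x) = consMap s n (mapCoeff θ n x) := by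
  induction x using Finsupp.induction_linear with
  | zero => simp
  | add x y hx hy => simp [hx, hy]
  | single w c => simp [consMap, mapCoeff_single, Finsupp.mapDomain_single]

theorem Surf.act_eq_mapCoeff : {a b : ℕ} → (g : Surf a b) → (r : ℕ) → (w : Word (r + a)) →
    g.act θ r w = mapCoeff θ _ (g.act (RingHom.id Coeff) r w)
  | _, _, .merge, _, .cons .plus (.cons .plus w) => by simp [Surf.act, mapCoeff_single]
  | _, _, .merge, _, .cons .plus (.cons .minus w) => by simp [Surf.act, mapCoeff_single]
  | _, _, .merge, _, .cons .minus (.cons .plus w) => by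
    simp only [Surf.act, mapCoeff_single, RingHom.id_apply]
  | _, _, .merge, _, .cons .minus (.cons .minus _) => by simp [Surf.act]
  | _, _, .split, _, .cons .plus w => by
    simp only [Surf.act, mapCoeff_single, RingHom.id_apply, map_add, map_one]
  | _, _, .split, _, .cons .minus w => by simp [Surf.act, mapCoeff_single]
  | _, _, .birth, _, w => by simp [Surf.act, mapCoeff_single]
  | _, _, .deathPos, _, .cons .plus _ => by simp [Surf.act]
  | _, _, .deathPos, _, .cons .minus w => by simp [Surf.act, mapCoeff_single]
  | _, _, .deathNeg, _, .cons .plus _ => by simp [Surf.act]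
  | _, _, .deathNeg, _, .cons .minus w => by simp [Surf.act, mapCoeff_single]
  | _, _, .twist, _, .cons s (.cons t w) => by simp [Surf.act, mapCoeff_single]

theorem Gen.act_elem {a b : ℕ} (g : Surf a b) (r : ℕ) (w : Word (r + a)) :
    (Gen.elem g r).act θ (.single w 1) = g.act θ r w := by
  simp [Gen.act]

theorem Gen.act_cyl_cons {a b : ℕ} (g : Gen a b) (s : VGen) (w : Word a) :
    (Gen.cyl g).act θ (.single (.cons s w) 1) =
      θ (lam g.deg s.deg) • consMap s b (g.act θ (.single w 1)) := by
  simp [Gen.act]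

theorem linearMap_mapCoeff {m n : ℕ} {f : (Word m →₀ Coeff) →ₗ[Coeff] (Word n →₀ Coeff)}
    {f' : (Word m →₀ R) →ₗ[R] (Word n →₀ R)}
    (h : ∀ w, f' (.single w 1) = mapCoeff θ n (f (.single w 1))) (x : Word m →₀ Coeff) :
    f' (mapCoeff θ m x) = mapCoeff θ n (f x) := by
  induction x using Finsupp.induction_linear with
  | zero => simp
  | add x y hx hy => simp [hx, hy]
  | single w c =>
    have h1 : Finsupp.single w c = c • Finsupp.single w (1 : Coeff) := by simp
    rw [h1, mapCoeff_smul, map_smul, map_smul, mapCoeff_smul, ← h, mapCoeff_single, map_one]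

theorem Gen.act_mapCoeff {a b : ℕ} (g : Gen a b) (x : Word a →₀ Coeff) :
    g.act θ (mapCoeff θ a x) = mapCoeff θ b (g.act (RingHom.id Coeff) x) := by
  induction g with
  | elem g r =>
    refine linearMap_mapCoeff θ (fun w => ?_) x
    rw [Gen.act_elem, Gen.act_elem, Surf.act_eq_mapCoeff]
  | cyl g ih =>
    refine linearMap_mapCoeff θ (fun w => ?_) x
    cases w with
    | cons s w =>
      have := ih (.single w 1)
      rw [mapCoeff_single, map_one] at this
      rw [Gen.act_cyl_cons, Gen.act_cyl_cons, mapCoeff_smul, mapCoeff_consMap, this]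
      rfl

/-- The linear map of a cobordism, for general parameters, is obtained by applying a ring
homomorphism to the matrix entries. -/
theorem Cob.act_mapCoeff {a b : ℕ} (W : Cob a b) (x : Word a →₀ Coeff) :
    W.act θ (mapCoeff θ a x) = mapCoeff θ b (W.act (RingHom.id Coeff) x) := by
  induction W with
  | id => simp [Cob.act]
  | snoc W g ih => simp only [Cob.act, LinearMap.comp_apply, ih, Gen.act_mapCoeff]

theorem Cob.act_single_apply {a b : ℕ} (W : Cob a b) (w : Word a) (w' : Word b) :
    W.act θ (.single w 1) w' = θ (W.act (RingHom.id Coeff) (.single w 1) w') := by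
  rw [← mapCoeff_apply, ← Cob.act_mapCoeff, mapCoeff_single, map_one]

end Map

/-! ### Homogeneity of the linear maps of cobordisms -/

/-- A linear combination of generators is homogeneous of degree `d`. -/
def IsHomog {n : ℕ} (d : SDeg) (x : Word n →₀ Coeff) : Prop :=
  ∀ w, x w ∈ coeffGrade (d - w.sdeg)

theorem isHomog_zero {n : ℕ} (d : SDeg) : IsHomog d (0 : Word n →₀ Coeff) :=
  fun _ => zero_mem _

theorem IsHomog.add {n : ℕ} {d : SDeg} {x y : Word n →₀ Coeff} (hx : IsHomog d x)
    (hy : IsHomog d y) : IsHomog d (x + y) :=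
  fun w => add_mem (hx w) (hy w)

theorem IsHomog.smul {n : ℕ} {d e : SDeg} {c : Coeff} {x : Word n →₀ Coeff}
    (hc : c ∈ coeffGrade e) (hx : IsHomog d x) : IsHomog (e + d) (c • x) := fun w => by
  rw [add_sub_assoc]
  exact mul_mem_coeffGrade hc (hx w)

theorem isHomog_single {n : ℕ} {d : SDeg} {c : Coeff} {w : Word n}
    (h : c ∈ coeffGrade (d - w.sdeg)) : IsHomog d (.single w c) := by
  classical
  intro w'
  rw [Finsupp.single_apply]
  split_ifs with hw
  · exact hw ▸ h
  · exact zero_mem _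

/-- The coefficient of $w$ in $x$ has degree $d-\mathrm{sdeg}\,w$, which cancels the dependence on
$w$ of the degree of $f(w)$. So homogeneity needs to be checked on generators only. -/
theorem IsHomog.map {m n : ℕ} {f : (Word m →₀ Coeff) →ₗ[Coeff] (Word n →₀ Coeff)} {e : SDeg}
    (hf : ∀ w, IsHomog (w.sdeg + e) (f (.single w 1))) {d : SDeg} {x : Word m →₀ Coeff}
    (hx : IsHomog d x) : IsHomog (d + e) (f x) := by
  have h : f x = ∑ w ∈ x.support, x w • f (.single w 1) := by
    conv_lhs => rw [← Finsupp.sum_single x, Finsupp.sum, map_sum]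
    refine Finset.sum_congr rfl fun w _ => ?_
    rw [← map_smul, Finsupp.smul_single, smul_eq_mul, mul_one]
  rw [h]
  refine Finset.sum_induction _ (IsHomog (d + e)) (fun _ _ => IsHomog.add) (isHomog_zero _) ?_
  intro w _
  have := IsHomog.smul (hx w) (hf w)
  rwa [← add_assoc, sub_add_cancel] at this

theorem lam_mem_coeffGrade (p q : ℤ × ℤ) :
    lam p q ∈ coeffGrade (((p.1 * q.1 + p.2 * q.2 : ℤ) : ZMod 2), q.1 * p.2 - p.1 * q.2) :=
  mono_mem_coeffGrade_of_eq (by simp)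

theorem isHomog_mono {n : ℕ} {d : SDeg} {m : ZMod 2 × ZMod 2 × ℤ} {w : Word n}
    (h : d = (m.1 + m.2.1, -m.2.2) + w.sdeg) : IsHomog d (.single w (mono m)) :=
  isHomog_single (mono_mem_coeffGrade_of_eq (by rw [h, add_sub_cancel_right]))

/-- A check of the defining table, one generator at a time. The `r` tubes on the right matter
because the degree of a factor $v_-$ depends on the number of factors to its right. -/
theorem Surf.act_isHomog {a b : ℕ} (g : Surf a b) (r : ℕ) (w : Word (r + a)) :
    IsHomog (w.sdeg + (Gen.elem g r).sdeg) (g.act (RingHom.id Coeff) r w) := by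
  have h2 : (1 : ZMod 2) + 1 = 0 := rfl
  have h2' : (-1 : ZMod 2) = 1 := rfl
  match a, b, g, w with
  | _, _, .merge, .cons .plus (.cons .plus w) =>
    -- The coefficient 1 is the monomial `mono 0`.
    refine isHomog_mono (m := 0) ?_
    ext <;> simp [Word.sdeg, Gen.sdeg, Surf.sdeg, Surf.deg, VGen.sdeg, VGen.deg]
  | _, _, .merge, .cons .plus (.cons .minus w) =>
    refine isHomog_mono (m := 0) ?_
    ext <;> simp [Word.sdeg, Gen.sdeg, Surf.sdeg, Surf.deg, VGen.sdeg, VGen.deg]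
  | _, _, .merge, .cons .minus (.cons .plus w) =>
    simp only [Surf.act, RingHom.id_apply, X_eq, Z_eq, mono_mul]
    refine isHomog_mono ?_
    ext <;> simp [Word.sdeg, Gen.sdeg, Surf.sdeg, Surf.deg, VGen.sdeg, VGen.deg] <;> grind
  | _, _, .merge, .cons .minus (.cons .minus _) => exact isHomog_zero _
  | _, _, .split, .cons .plus w =>
    simp only [Surf.act, RingHom.id_apply, Y_eq, Z_eq, mono_mul]
    refine IsHomog.add (isHomog_mono (m := 0) ?_) (isHomog_mono ?_)
    · ext <;> simp [Word.sdeg, Gen.sdeg, Surf.sdeg, Surf.deg, VGen.sdeg, VGen.deg] <;> grind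
    · ext <;> simp [Word.sdeg, Gen.sdeg, Surf.sdeg, Surf.deg, VGen.sdeg, VGen.deg] <;> grind
  | _, _, .split, .cons .minus w =>
    refine isHomog_mono (m := 0) ?_
    ext <;> simp [Word.sdeg, Gen.sdeg, Surf.sdeg, Surf.deg, VGen.sdeg, VGen.deg] <;> grind
  | _, _, .birth, w =>
    refine isHomog_mono (m := 0) ?_
    ext <;> simp [Word.sdeg, Gen.sdeg, Surf.sdeg, Surf.deg, VGen.sdeg, VGen.deg]
  | _, _, .deathPos, .cons .plus _ => exact isHomog_zero _
  | _, _, .deathPos, .cons .minus w =>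
    refine isHomog_mono (m := (0, 1, 0)) ?_
    ext <;> simp [Word.sdeg, Gen.sdeg, Surf.sdeg, Surf.deg, VGen.sdeg, VGen.deg] <;> grind
  | _, _, .deathNeg, .cons .plus _ => exact isHomog_zero _
  | _, _, .deathNeg, .cons .minus w =>
    refine isHomog_mono (m := 0) ?_
    ext <;> simp [Word.sdeg, Gen.sdeg, Surf.sdeg, Surf.deg, VGen.sdeg, VGen.deg] <;> grind
  | _, _, .twist, .cons s (.cons t w) =>
    refine isHomog_mono ?_
    cases s <;> cases t <;> ext <;>
      simp [Word.sdeg, Gen.sdeg, Surf.sdeg, Surf.deg, VGen.sdeg, VGen.deg] <;> grind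

theorem IsHomog.consMap {n : ℕ} {d : SDeg} {x : Word n →₀ Coeff} (hx : IsHomog d x) (s : VGen) :
    IsHomog (d + (s.sdeg + (((s.deg.2 * n : ℤ) : ZMod 2), s.deg.2 * n)))
      (consMap s n x) := by
  refine hx.map fun w => ?_
  rw [GenKh.consMap, Finsupp.lmapDomain_apply, Finsupp.mapDomain_single]
  refine isHomog_mono (m := 0) ?_
  ext <;> simp [Word.sdeg] <;> ring

theorem Surf.deg_sub {a b : ℕ} (g : Surf a b) : (b : ℤ) = a + g.deg.1 - g.deg.2 := by
  cases g <;> rfl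

/-- A birth or a split adds a circle, a merge or a death removes one. This ties the number of
circles to the chronological degree, as needed to compare the position of a leading $v_-$ before and
after a cobordism. -/
theorem Gen.deg_sub {a b : ℕ} (g : Gen a b) : (b : ℤ) = a + g.deg.1 - g.deg.2 := by
  induction g with
  | elem g r => push_cast; rw [Gen.deg, g.deg_sub]; ring
  | cyl g ih => push_cast; rw [Gen.deg, ih]; ring

theorem Gen.act_isHomog {a b : ℕ} (g : Gen a b) (w : Word a) :
    IsHomog (w.sdeg + g.sdeg) (g.act (RingHom.id Coeff) (.single w 1)) := by
  have h2' : (-1 : ZMod 2) = 1 := rfl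
  induction g with
  | elem g r => rw [Gen.act_elem]; exact Surf.act_isHomog g r w
  | cyl g ih =>
    cases w with
    | cons s w =>
      rw [Gen.act_cyl_cons, RingHom.id_apply]
      convert IsHomog.smul (lam_mem_coeffGrade g.deg s.deg) ((ih w).consMap s) using 1
      -- The shift of a leading $v_-$ changes because `g` turns the factors behind it from `a` into
      -- `b` many. Together with the degree of $\lambda(\deg g,\deg s)$ this change accounts for the
      -- term $(\alpha,\beta)$ of a tube on the left.
      have h : (_ : ℤ) = _ := g.deg_sub
      have h' := congrArg (Int.cast : ℤ → ZMod 2) h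
      push_cast at h'
      cases s <;> ext <;> simp [Word.sdeg, Gen.sdeg, VGen.sdeg, VGen.deg] <;> grind

/-- The linear maps of cobordisms are homogeneous with respect to the splitting degree. -/
theorem Cob.act_isHomog {a b : ℕ} (W : Cob a b) (w : Word a) :
    IsHomog (w.sdeg + W.sdeg) (W.act (RingHom.id Coeff) (.single w 1)) := by
  induction W with
  | id =>
    rw [Cob.sdeg, add_zero, Cob.act, LinearMap.id_apply]
    exact isHomog_mono (d := w.sdeg) (m := 0) (w := w) (by ext <;> simp)
  | snoc W g ih =>
    rw [Cob.act, Cob.sdeg, ← add_assoc]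
    exact ih.map g.act_isHomog

/-! ### Nonvanishing of compositions of saddles -/

/-- The homomorphism that sends `X`, `Y` and `Z` to `1`. -/
def augmentation : Coeff →+* ℤ :=
  (AddMonoidAlgebra.lift ℤ ℤ (ZMod 2 × ZMod 2 × ℤ) 1 : Coeff →ₐ[ℤ] ℤ)

theorem augmentation_mono (m : ZMod 2 × ZMod 2 × ℤ) : augmentation (mono m) = 1 := by
  simp [augmentation, mono]

theorem augmentation_lam (p q : ℤ × ℤ) : augmentation (lam p q) = 1 :=
  augmentation_mono _

/-- With all parameters equal to 1 the matrix entries are 0 or 1. Nonnegativity excludes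
cancellation in compositions. -/
theorem Surf.act_nonneg {a b : ℕ} (g : Surf a b) (r : ℕ) (w : Word (r + a)) :
    0 ≤ g.act augmentation r w := by
  match a, b, g, w with
  | _, _, .merge, .cons .plus (.cons .plus w) => simp [Surf.act]
  | _, _, .merge, .cons .plus (.cons .minus w) => simp [Surf.act]
  | _, _, .merge, .cons .minus (.cons .plus w) =>
    simp [Surf.act, X_eq, Z_eq, augmentation_mono]
  | _, _, .merge, .cons .minus (.cons .minus _) => exact le_rfl
  | _, _, .split, .cons .plus w =>
    simp only [Surf.act, Y_eq, Z_eq, mono_mul, augmentation_mono]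
    exact add_nonneg (by simp) (by simp)
  | _, _, .split, .cons .minus w => simp [Surf.act]
  | _, _, .birth, w => simp [Surf.act]
  | _, _, .deathPos, .cons .plus _ => exact le_rfl
  | _, _, .deathPos, .cons .minus w => simp [Surf.act, Y_eq, augmentation_mono]
  | _, _, .deathNeg, .cons .plus _ => exact le_rfl
  | _, _, .deathNeg, .cons .minus w => simp [Surf.act]
  | _, _, .twist, .cons s (.cons t w) => simp [Surf.act, augmentation_lam]

theorem linearMap_nonneg {m n : ℕ} {f : (Word m →₀ ℤ) →ₗ[ℤ] (Word n →₀ ℤ)}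
    (hf : ∀ w, 0 ≤ f (.single w 1)) {x : Word m →₀ ℤ} (hx : 0 ≤ x) : 0 ≤ f x := by
  have h : f x = ∑ w ∈ x.support, x w • f (.single w 1) := by
    conv_lhs => rw [← Finsupp.sum_single x, Finsupp.sum, map_sum]
    refine Finset.sum_congr rfl fun w _ => ?_
    rw [← map_smul, Finsupp.smul_single, smul_eq_mul, mul_one]
  rw [h]
  exact Finset.sum_nonneg fun w _ => smul_nonneg (hx w) (hf w)

theorem consMap_mono {n : ℕ} (s : VGen) {x y : Word n →₀ ℤ} (hxy : x ≤ y) :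
    consMap s n x ≤ consMap s n y := by
  rw [← sub_nonneg, ← map_sub]
  refine linearMap_nonneg (fun w => ?_) (sub_nonneg.2 hxy)
  simp [consMap, Finsupp.mapDomain_single]

theorem Gen.act_nonneg {a b : ℕ} (g : Gen a b) (w : Word a) :
    0 ≤ g.act augmentation (.single w 1) := by
  induction g with
  | elem g r => rw [Gen.act_elem]; exact g.act_nonneg r w
  | cyl g ih =>
    cases w with
    | cons s w =>
      rw [Gen.act_cyl_cons, augmentation_lam, one_smul, ← map_zero (consMap s _)]
      exact consMap_mono s (ih w)

theorem Cob.act_nonneg {a b : ℕ} (W : Cob a b) {x : Word a →₀ ℤ} (hx : 0 ≤ x) :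
    0 ≤ W.act augmentation x := by
  induction W with
  | id => rwa [Cob.act]
  | snoc W g ih => rw [Cob.act]; exact linearMap_nonneg g.act_nonneg ih

/-- The generator `w'` occurs in the image of the generator `w` when the parameters are `1`. -/
def Cob.Takes {a b : ℕ} (W : Cob a b) (w : Word a) (w' : Word b) : Prop :=
  .single w' 1 ≤ W.act augmentation (.single w 1)

/-- A linear map with nonnegative entries is monotone, so a lower bound by a generator can be
followed through a composition. -/
theorem Cob.Takes.comp {a b c : ℕ} {V : Cob a b} {W : Cob b c} {w : Word a} {w' : Word b}
    {w'' : Word c} (h : V.Takes w w') (h' : W.Takes w' w'') : (V.comp W).Takes w w'' := by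
  rw [Takes, Cob.act_comp, LinearMap.comp_apply]
  refine le_trans h' (sub_nonneg.1 ?_)
  rw [← map_sub]
  exact W.act_nonneg (sub_nonneg.2 h)

theorem Cob.Takes.cyl {a b : ℕ} {W : Cob a b} {w : Word a} {w' : Word b} (h : W.Takes w w')
    (s : VGen) : W.cyl.Takes (.cons s w) (.cons s w') := by
  have hc : ∀ {n : ℕ} (w : Word n),
      Finsupp.single (Word.cons s w) (1 : ℤ) = consMap s n (.single w 1) := fun w => by
    simp [consMap, Finsupp.mapDomain_single]
  rw [Takes, hc, hc, Cob.act_cyl, augmentation_lam, one_smul]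
  exact consMap_mono s h

theorem Gen.toCob_act {R : Type} [CommRing R] (θ : Coeff →+* R) {a b : ℕ} (g : Gen a b)
    (x : Word a →₀ R) : g.toCob.act θ x = g.act θ x := by
  rw [toCob, Cob.act, Cob.act, LinearMap.comp_id]

/-- A generator with nonzero entry has a nonzero entry for the universal parameters. -/
theorem Cob.Takes.act_ne_zero {a b : ℕ} {W : Cob a b} {w : Word a} {w' : Word b}
    (h : W.Takes w w') : W.act (RingHom.id Coeff) (.single w 1) w' ≠ 0 := by
  intro h0
  have h1 : (Finsupp.single w' (1 : ℤ)) w' ≤ W.act augmentation (.single w 1) w' := h w'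
  rw [Cob.act_single_apply, h0, map_zero, Finsupp.single_eq_same] at h1
  exact absurd h1 (by norm_num)

/-- The number of factors `v₋`. -/
def Word.minuses : {n : ℕ} → Word n → ℕ
  | _, .nil => 0
  | _, .cons .plus w => w.minuses
  | _, .cons .minus w => w.minuses + 1

/-- Each generator is taken to one with as many factors `v₋`. -/
def Cob.Preserves {a b : ℕ} (W : Cob a b) : Prop :=
  ∀ w : Word a, ∃ w' : Word b, W.Takes w w' ∧ w'.minuses = w.minuses

theorem Cob.preserves_id (a : ℕ) : (Cob.id a).Preserves :=
  fun w => ⟨w, by rw [Takes, Cob.act, LinearMap.id_apply], rfl⟩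

theorem Cob.Preserves.comp {a b c : ℕ} {V : Cob a b} {W : Cob b c} (hV : V.Preserves)
    (hW : W.Preserves) : (V.comp W).Preserves := fun w => by
  obtain ⟨w', h, e⟩ := hV w
  obtain ⟨w'', h', e'⟩ := hW w'
  exact ⟨w'', h.comp h', e'.trans e⟩

theorem Cob.Preserves.cyl {a b : ℕ} {W : Cob a b} (hW : W.Preserves) : W.cyl.Preserves
  | .cons s w => by
    obtain ⟨w', h, e⟩ := hW w
    refine ⟨_, h.cyl s, ?_⟩
    cases s
    · exact e
    · exact congrArg (· + 1) e

theorem preserves_twist (r : ℕ) : (twist r).Preserves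
  | .cons s (.cons t w) => by
    refine ⟨.cons t (.cons s w), ?_, by cases s <;> cases t <;> rfl⟩
    rw [Cob.Takes, Gen.toCob_act, Gen.act_elem, Surf.act, augmentation_lam]

theorem preserves_bringFront : (m : ℕ) → (p : Fin (m + 1)) → (bringFront m p).Preserves
  | 0, _ => Cob.preserves_id 1
  | m + 1, p => by
    refine Fin.cases ?_ (fun q => ?_) p
    · exact Cob.preserves_id (m + 2)
    · exact (preserves_bringFront m q).cyl.comp (preserves_twist m)

theorem preserves_permCob : (m m' : ℕ) → (e : Fin m' ≃ Fin m) → (permCob m m' e).Preserves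
  | 0, 0, _ => Cob.preserves_id 0
  | m + 1, m' + 1, e => (preserves_bringFront m (e 0)).comp (preserves_permCob m m' _).cyl
  | 0, _ + 1, e => (e 0).elim0
  | _ + 1, 0, e => (e.symm 0).elim0

/-- A merge kills only generators that begin with $v_-\otimes v_-$, and the bound on the number of
factors $v_-$ excludes these. -/
theorem merge_takes (r : ℕ) (w : Word (r + 2)) (hw : w.minuses ≤ 1) :
    ∃ w', (merge r).Takes w w' ∧ w'.minuses ≤ w.minuses + 1 := by
  match w with
  | .cons .plus (.cons s w) =>
    refine ⟨.cons s w, ?_, by cases s <;> simp [Word.minuses]⟩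
    cases s <;> rw [Cob.Takes, Gen.toCob_act, Gen.act_elem, Surf.act]
  | .cons .minus (.cons .plus w) =>
    refine ⟨.cons .minus w, ?_, by simp [Word.minuses]⟩
    rw [Cob.Takes, Gen.toCob_act, Gen.act_elem, Surf.act, X_eq, Z_eq, mono_mul,
      augmentation_mono]
  | .cons .minus (.cons .minus w) => simp [Word.minuses] at hw

theorem split_takes (r : ℕ) (w : Word (r + 1)) :
    ∃ w', (split r).Takes w w' ∧ w'.minuses ≤ w.minuses + 1 := by
  match w with
  | .cons .plus w =>
    refine ⟨.cons .minus (.cons .plus w), ?_, by simp [Word.minuses]⟩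
    rw [Cob.Takes, Gen.toCob_act, Gen.act_elem, Surf.act, Y_eq, Z_eq, mono_mul,
      augmentation_mono]
    exact le_add_of_nonneg_right (by simp)
  | .cons .minus w =>
    refine ⟨.cons .minus (.cons .minus w), ?_, by simp [Word.minuses]⟩
    rw [Cob.Takes, Gen.toCob_act, Gen.act_elem, Surf.act]

/-- The permutations before and after the merge or split keep the number of factors $v_-$, so the
ordering of the circles plays no role. -/
theorem Saddle.takes {D : LinkDiagram} {arrow : Bool} {i : Fin D.crossings} {ξ ξ' : D.Vertex}
    {m m' : ℕ} (a : Fin m ≃ D.Circle ξ) (a' : Fin m' ≃ D.Circle ξ') (S : Saddle D arrow i ξ ξ')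
    (w : Word m) (hw : w.minuses ≤ 1) :
    ∃ w', (S.cob a a').Takes w w' ∧ w'.minuses ≤ w.minuses + 1 := by
  cases S with
  | merge r b b' =>
    obtain ⟨w₁, h₁, e₁⟩ := preserves_permCob _ _ (b.trans a.symm) w
    obtain ⟨w₂, h₂, e₂⟩ := merge_takes r w₁ (e₁ ▸ hw)
    obtain ⟨w₃, h₃, e₃⟩ := preserves_permCob _ _ (a'.trans b'.symm) w₂
    exact ⟨w₃, h₁.comp (h₂.comp h₃), e₃.trans_le (e₁ ▸ e₂)⟩
  | split r b b' =>
    obtain ⟨w₁, h₁, e₁⟩ := preserves_permCob _ _ (b.trans a.symm) w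
    obtain ⟨w₂, h₂, e₂⟩ := split_takes r w₁
    obtain ⟨w₃, h₃, e₃⟩ := preserves_permCob _ _ (a'.trans b'.symm) w₂
    exact ⟨w₃, h₁.comp (h₂.comp h₃), e₃.trans_le (e₁ ▸ e₂)⟩

/-- The word without factors `v₋`. -/
def Word.pluses : (n : ℕ) → Word n
  | 0 => .nil
  | n + 1 => .cons .plus (Word.pluses n)

theorem Word.minuses_pluses (n : ℕ) : (Word.pluses n).minuses = 0 := by
  induction n with
  | zero => rfl
  | succ n ih => exact ih

/-- The linear map of a composition of two saddles in the cube does not vanish. -/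
theorem Decoration.exists_act_ne_zero {D : LinkDiagram} (c : Decoration D)
    {i j : Fin D.crossings} {ξ ξ₁ ξ' : D.Vertex} (h₁ : IsEdge i ξ ξ₁) (h₂ : IsEdge j ξ₁ ξ') :
    ∃ w w', ((c.cob h₁).comp (c.cob h₂)).act (RingHom.id Coeff) (.single w 1) w' ≠ 0 := by
  -- Starting from $v_+\otimes\dots\otimes v_+$, the first saddle leaves a generator with at most
  -- one $v_-$, which the second saddle cannot kill.
  have h0 := Word.minuses_pluses (c.size ξ)
  obtain ⟨w₁, t₁, e₁⟩ := (c.saddle h₁).takes (c.order ξ) (c.order ξ₁) (.pluses _) (by simp [h0])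
  obtain ⟨w₂, t₂, -⟩ := (c.saddle h₂).takes (c.order ξ₁) (c.order ξ') w₁ (by simpa [h0] using e₁)
  exact ⟨_, _, (t₁.comp t₂).act_ne_zero⟩

/-! ### Change of parameters in the category of cobordisms -/

section ChangeOfParameters

variable (f : Coeff →+* Coeff)

/-- Applying a ring homomorphism to the coefficients of a linear combination of cobordisms. -/
def freeMap (a b : Free Coeff Circles) : (a ⟶ b) →+ (a ⟶ b) :=
  (Finsupp.mapRange.addMonoidHom (f : Coeff →+ Coeff) :
    (Quiver.Hom (V := Circles) a b →₀ Coeff) →+ (Quiver.Hom (V := Circles) a b →₀ Coeff))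

theorem freeMap_single {a b : Circles} (W : a ⟶ b) (r : Coeff) :
    freeMap f (Free.of Coeff a) (Free.of Coeff b) (Finsupp.single W r) =
      (Finsupp.single W (f r) : Quiver.Hom (V := Circles) a b →₀ Coeff) :=
  Finsupp.mapRange_single (hf := map_zero f)

theorem freeMap_smul {a b : Free Coeff Circles} (r : Coeff) (x : a ⟶ b) :
    freeMap f a b (r • x) = f r • freeMap f a b x :=
  Finsupp.ext fun _ => map_mul f r _

theorem freeMap_embedding {a b : Circles} (W : a ⟶ b) :
    freeMap f _ _ ((Free.embedding Coeff Circles).map W) = (Free.embedding Coeff Circles).map W :=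
  (freeMap_single f W 1).trans (by rw [map_one]; rfl)

theorem free_induction {a b : Circles}
    {P : ((Free.embedding Coeff Circles).obj a ⟶ (Free.embedding Coeff Circles).obj b) → Prop}
    (zero : P 0) (add : ∀ x y, P x → P y → P (x + y))
    (smul : ∀ (r : Coeff) (W : a ⟶ b), P (r • (Free.embedding Coeff Circles).map W)) (x) : P x := by
  refine Finsupp.induction_linear (motive := P) x zero add fun W r => ?_
  have h : r • (Free.embedding Coeff Circles).map W =
      (Finsupp.single W r : Quiver.Hom (V := Circles) a b →₀ Coeff) :=
    (Finsupp.smul_single r W (1 : Coeff)).trans (by rw [smul_eq_mul, mul_one]; rfl)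
  exact h ▸ smul r W

theorem freeMap_comp_aux {a b c : Circles}
    (x : (Free.embedding Coeff Circles).obj a ⟶ (Free.embedding Coeff Circles).obj b)
    (y : (Free.embedding Coeff Circles).obj b ⟶ (Free.embedding Coeff Circles).obj c) :
    freeMap f _ _ (x ≫ y) = freeMap f _ _ x ≫ freeMap f _ _ y := by
  induction x using free_induction with
  | zero => rw [zero_comp, map_zero, map_zero, zero_comp]
  | add x x' hx hx' => rw [Preadditive.add_comp, map_add, map_add, hx, hx', Preadditive.add_comp]
  | smul r W =>
    induction y using free_induction with
    | zero => rw [comp_zero, map_zero, map_zero, comp_zero]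
    | add y y' hy hy' =>
      rw [Preadditive.comp_add, map_add, map_add, hy, hy', Preadditive.comp_add]
    | smul s V =>
      simp only [Linear.smul_comp, Linear.comp_smul, ← Functor.map_comp, freeMap_smul,
        freeMap_embedding]

theorem freeMap_comp {a b c : Free Coeff Circles} (x : a ⟶ b) (y : b ⟶ c) :
    freeMap f a c (x ≫ y) = freeMap f a b x ≫ freeMap f b c y :=
  freeMap_comp_aux f (a := a) (b := b) (c := c) x y

/-- A generating relation $p(U-cV)q$ goes to $f(p)(U-f(c)V)f(q)$, a relation for the parameters
changed by $f$. -/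
theorem freeMap_mem_relIdeal {a b : Free Coeff Circles} {x : a ⟶ b}
    (hx : x ∈ relIdeal (RingHom.id Coeff) a b) : freeMap f a b x ∈ relIdeal f a b := by
  refine Submodule.span_induction (p := fun x _ => freeMap f a b x ∈ relIdeal f a b)
    ?_ ?_ ?_ ?_ hx
  · rintro _ ⟨m, n, p, U, V, c, q, h, rfl⟩
    refine Submodule.subset_span ⟨m, n, freeMap f _ _ p, U, V, c, freeMap f _ _ q, h, ?_⟩
    rw [freeMap_comp, freeMap_comp, map_sub, freeMap_smul, freeMap_embedding, freeMap_embedding,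
      RingHom.id_apply]
  · rw [map_zero]; exact zero_mem _
  · intro x y _ _ hx hy
    rw [map_add]
    exact add_mem hx hy
  · intro r x _ hx
    rw [freeMap_smul]
    exact Submodule.smul_mem _ _ hx

theorem smul_mk_add_smul_mk_eq_zero_iff (θ : Coeff →+* Coeff) {a b : ℕ} (U V : Cob a b)
    (r s : Coeff) : r • ChCob.mk θ U + s • ChCob.mk θ V = 0 ↔
      r • (Free.embedding Coeff Circles).map (X := ⟨a⟩) (Y := ⟨b⟩) U +
        s • (Free.embedding Coeff Circles).map (X := ⟨a⟩) (Y := ⟨b⟩) V ∈ relIdeal θ _ _ := by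
  have h : r • ChCob.mk θ U + s • ChCob.mk θ V = (Quotient.functor (chHomRel θ)).map
      (r • (Free.embedding Coeff Circles).map (X := ⟨a⟩) (Y := ⟨b⟩) U +
        s • (Free.embedding Coeff Circles).map (X := ⟨a⟩) (Y := ⟨b⟩) V) := rfl
  rw [h, ← (Quotient.functor (chHomRel θ)).map_zero]
  refine (Quotient.functor_map_eq_iff (chHomRel θ) _ _).trans ?_
  exact iff_of_eq (congrArg (· ∈ relIdeal θ _ _) (sub_zero _))

/-- A linear relation between two cobordisms remains valid after a change of parameters. -/
theorem smul_mk_add_smul_mk_eq_zero {a b : ℕ} {U V : Cob a b} {r s : Coeff}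
    (h : r • ChCob.mk (RingHom.id Coeff) U + s • ChCob.mk (RingHom.id Coeff) V = 0) :
    f r • ChCob.mk f U + f s • ChCob.mk f V = 0 := by
  rw [smul_mk_add_smul_mk_eq_zero_iff] at h ⊢
  have := freeMap_mem_relIdeal f h
  rwa [map_add, freeMap_smul, freeMap_smul, freeMap_embedding, freeMap_embedding] at this

end ChangeOfParameters

section

variable {R : Type} [CommRing R] (θ : Coeff →+* R)

theorem smul_mk_comp_smul_mk {a b c : ℕ} (V : Cob a b) (W : Cob b c) (r s : R) :
    (r • ChCob.mk θ V) ≫ (s • ChCob.mk θ W) = (r * s) • ChCob.mk θ (V.comp W) := by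
  have : ChCob.mk θ V ≫ ChCob.mk θ W = ChCob.mk θ (V.comp W) := by
    refine ((Quotient.functor (chHomRel θ)).map_comp _ _).symm.trans ?_
    exact congrArg _ ((Free.embedding R Circles).map_comp (X := ⟨a⟩) (Y := ⟨b⟩) (Z := ⟨c⟩) V W).symm
  rw [Linear.smul_comp, Linear.comp_smul, this, smul_smul]

/-- The linear map of a multiple of a cobordism. -/
theorem tqft_map_smul_mk {a b : ℕ} (W : Cob a b) (r : R) :
    (tqft θ).map (r • ChCob.mk θ W) = ModuleCat.ofHom (r • W.act θ) := by
  have h : r • (Free.embedding R Circles).map (X := ⟨a⟩) (Y := ⟨b⟩) W =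
      (Finsupp.single W r : Quiver.Hom (V := Circles) ⟨a⟩ ⟨b⟩ →₀ R) :=
    (Finsupp.smul_single r W (1 : R)).trans (by rw [smul_eq_mul, mul_one])
  refine Eq.trans (b := (Free.lift R (cobFunctor θ)).map
    (r • (Free.embedding R Circles).map (X := ⟨a⟩) (Y := ⟨b⟩) W)) rfl ?_
  rw [h]
  exact Free.lift_map_single R (cobFunctor θ) (X := ⟨a⟩) (Y := ⟨b⟩) W r

end

/-- Anticommutation on a face is a linear relation between two composite cobordisms, and such
relations survive a change of parameters. -/
theorem IsSignAssignment.map {D : LinkDiagram} {c : Decoration D} {ε : EdgeCochain D Coeff}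
    (hε : IsSignAssignment (RingHom.id Coeff) c ε) (f : Coeff →+* Coeff) :
    IsSignAssignment f c (ε.map f) := by
  intro i j ξ ξ₁ ξ₂ ξ' h₁ h₂ k₁ k₂
  have h := hε h₁ h₂ k₁ k₂
  rw [smul_mk_comp_smul_mk, smul_mk_comp_smul_mk] at h ⊢
  have := smul_mk_add_smul_mk_eq_zero f h
  rwa [map_mul, map_mul] at this

/-! ### Closed cochains on the cube -/

section Cube

variable {D : LinkDiagram}

/-- The product of a cochain along a path. -/
def CubePath.prod {R : Type} [CommRing R] (F : EdgeCochain D R) :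
    {ξ : D.Vertex} → CubePath D ξ → Rˣ
  | _, .nil => 1
  | _, .snoc P h => P.prod F * F h

/-- The coboundary of the cochain is trivial. -/
def EdgeCochain.IsClosed {R : Type} [CommRing R] (F : EdgeCochain D R) : Prop :=
  ∀ ⦃i j : Fin D.crossings⦄ ⦃ξ ξ₁ ξ₂ ξ' : D.Vertex⦄ (h₁ : IsEdge i ξ ξ₁) (h₂ : IsEdge j ξ₁ ξ')
    (k₁ : IsEdge j ξ ξ₂) (k₂ : IsEdge i ξ₂ ξ'), F h₁ * F h₂ = F k₁ * F k₂

theorem isEdge_update {i : Fin D.crossings} {ξ : D.Vertex} (h : ξ i = true) :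
    IsEdge i (Function.update ξ i false) ξ := by
  refine ⟨Function.update_self .., ?_⟩
  rw [Function.update_idem, ← h, Function.update_eq_self]

theorem LinkDiagram.IsEdge.source_eq {i : Fin D.crossings} {η ξ : D.Vertex} (h : IsEdge i η ξ) :
    η = Function.update ξ i false := by
  rw [h.2, Function.update_idem, ← h.1, Function.update_eq_self]

theorem nonempty_cubePath (ξ : D.Vertex) : Nonempty (CubePath D ξ) := by
  induction hn : weight ξ generalizing ξ with
  | zero =>
    have h : ξ = fun _ => false := by
      funext i
      by_contra hi
      have : i ∈ Finset.univ.filter fun i => ξ i = true := by simpa using hi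
      rw [Finset.card_eq_zero.1 hn] at this
      simp at this
    exact h ▸ ⟨.nil⟩
  | succ n ih =>
    obtain ⟨i, hi⟩ := Finset.card_pos.1 (hn.symm ▸ n.succ_pos : 0 < weight ξ)
    have h := isEdge_update (Finset.mem_filter.1 hi).2
    have hw := h.weight_eq
    obtain ⟨P⟩ := ih _ (by omega : weight (Function.update ξ i false) = n)
    exact ⟨P.snoc h⟩

/-- Two edges of different directions into `ξ` are the upper half of a face; undoing both changes
gives its lowest vertex. -/
theorem exists_isEdge_of_ne {i j : Fin D.crossings} {η η' ξ : D.Vertex} (h : IsEdge i η ξ)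
    (k : IsEdge j η' ξ) (hij : i ≠ j) : ∃ ζ, IsEdge j ζ η ∧ IsEdge i ζ η' := by
  have hj : η j = true := by
    have h1 := congrFun h.2 j
    rw [Function.update_of_ne hij.symm, k.2, Function.update_self] at h1
    exact h1.symm
  refine ⟨Function.update η j false, isEdge_update hj, ?_, ?_⟩
  · rw [Function.update_of_ne hij, h.1]
  · rw [k.source_eq, h.2, Function.update_comm hij]

/-- A closed cochain has the same product along any two paths with the same endpoint. -/
theorem EdgeCochain.IsClosed.prod_eq {R : Type} [CommRing R] {F : EdgeCochain D R}
    (hF : F.IsClosed) {ξ : D.Vertex} (P Q : CubePath D ξ) : P.prod F = Q.prod F := by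
  -- Induction on the weight of the endpoint. The two endpoints are separate variables joined by an
  -- equation, so that both paths can be taken apart by cases.
  suffices H : ∀ n, ∀ {ξ ξ' : D.Vertex} (P : CubePath D ξ) (Q : CubePath D ξ'), weight ξ = n →
      ξ = ξ' → P.prod F = Q.prod F from H _ P Q rfl rfl
  intro n
  induction n with
  | zero =>
    intro ξ ξ' P Q hn h
    cases P with
    | snoc P e => have := e.weight_eq; omega
    | nil =>
      cases Q with
      | nil => rfl
      | snoc Q e => have := e.weight_eq; rw [← h] at this; omega
  | succ n ih =>
    intro ξ ξ' P Q hn h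
    have h0 : weight (fun _ => false : D.Vertex) = 0 := by simp [weight]
    cases P with
    | nil => omega
    | snoc P e =>
      cases Q with
      | nil => rw [h] at hn; omega
      | snoc Q k =>
        rename_i i η j η'
        subst h
        have hη : weight η = n := by have := e.weight_eq; omega
        have hη' : weight η' = n := by have := k.weight_eq; omega
        by_cases hij : i = j
        · subst hij
          obtain rfl : η = η' := e.source_eq.trans k.source_eq.symm
          exact congrArg (· * F e) (ih P Q hη rfl)
        -- The last edges span a face with lowest vertex `ζ`. By induction both initial segments may
        -- be rerouted along one path `S` through `ζ`, and closedness on this face compares the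
        -- rest.
        · obtain ⟨ζ, e', k'⟩ := exists_isEdge_of_ne e k hij
          obtain ⟨S⟩ := nonempty_cubePath ζ
          have h1 := ih P (S.snoc e') hη rfl
          have h2 := ih Q (S.snoc k') hη' rfl
          rw [CubePath.prod, CubePath.prod, h1, h2, CubePath.prod, CubePath.prod, mul_assoc,
            mul_assoc, hF e' e k' k]

end Cube

/-! ### The comparison of two sign assignments -/

theorem Cob.sdeg_comp {a b c : ℕ} (V : Cob a b) : (W : Cob b c) →
    (V.comp W).sdeg = V.sdeg + W.sdeg
  | .id _ => by simp [Cob.comp, Cob.sdeg]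
  | .snoc W g => by simp [Cob.comp, Cob.sdeg, V.sdeg_comp W, add_assoc]

theorem unitsMap_eq_rescaling_mul {φ : Coeff ≃+* Coeff}
    (hφ : ∀ (d : SDeg) (x : Coeff), x ∈ coeffGrade d → φ x ∈ coeffGrade d)
    (hXY : φ (X * Y) = X * Y) (u : Coeffˣ) :
    Units.map ((φ : Coeff →+* Coeff) : Coeff →* Coeff) u = rescaling φ (sdegScalar u) * u :=
  Units.ext (map_eq_rescaling_mul hφ hXY (mem_coeffGrade_sdegScalar u))

section Comparison

variable {D : LinkDiagram} (c : Decoration D)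

theorem IsSignAssignment.act_add_act_eq_zero {R : Type} [CommRing R] {θ : Coeff →+* R}
    {c : Decoration D} {ε : EdgeCochain D R} (hε : IsSignAssignment θ c ε)
    {i j : Fin D.crossings} {ξ ξ₁ ξ₂ ξ' : D.Vertex} (h₁ : IsEdge i ξ ξ₁) (h₂ : IsEdge j ξ₁ ξ')
    (k₁ : IsEdge j ξ ξ₂) (k₂ : IsEdge i ξ₂ ξ') :
    ((ε h₁ : R) * ε h₂) • ((c.cob h₁).comp (c.cob h₂)).act θ +
      ((ε k₁ : R) * ε k₂) • ((c.cob k₁).comp (c.cob k₂)).act θ = 0 := by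
  have h := congrArg (tqft θ).map (hε h₁ h₂ k₁ k₂)
  rw [smul_mk_comp_smul_mk, smul_mk_comp_smul_mk, Functor.map_add, Functor.map_zero,
    tqft_map_smul_mk, tqft_map_smul_mk] at h
  exact congrArg ModuleCat.Hom.hom h

/-- The two directed paths along a face of the corrected cube have the same splitting degree. -/
theorem IsSignAssignment.sdeg_eq {c : Decoration D} {ε : EdgeCochain D Coeff}
    (hε : IsSignAssignment (RingHom.id Coeff) c ε)
    {i j : Fin D.crossings} {ξ ξ₁ ξ₂ ξ' : D.Vertex} (h₁ : IsEdge i ξ ξ₁) (h₂ : IsEdge j ξ₁ ξ')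
    (k₁ : IsEdge j ξ ξ₂) (k₂ : IsEdge i ξ₂ ξ') :
    (sdegScalar (ε h₁) + (c.cob h₁).sdeg) + (sdegScalar (ε h₂) + (c.cob h₂).sdeg) =
      (sdegScalar (ε k₁) + (c.cob k₁).sdeg) + (sdegScalar (ε k₂) + (c.cob k₂).sdeg) := by
  obtain ⟨w, w', hne⟩ := c.exists_act_ne_zero h₁ h₂
  have h : ((ε h₁ : Coeff) * ε h₂) * ((c.cob h₁).comp (c.cob h₂)).act (RingHom.id Coeff)
      (.single w 1) w' + ((ε k₁ : Coeff) * ε k₂) * ((c.cob k₁).comp (c.cob k₂)).act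
        (RingHom.id Coeff) (.single w 1) w' = 0 :=
    DFunLike.congr_fun (LinearMap.congr_fun (hε.act_add_act_eq_zero h₁ h₂ k₁ k₂)
      (.single w 1)) w'
  have hmem : ∀ {i j : Fin D.crossings} {ζ : D.Vertex} (h₁ : IsEdge i ξ ζ) (h₂ : IsEdge j ζ ξ'),
      ((ε h₁ : Coeff) * ε h₂) * ((c.cob h₁).comp (c.cob h₂)).act (RingHom.id Coeff)
        (.single w 1) w' ∈ coeffGrade ((sdegScalar (ε h₁) + sdegScalar (ε h₂)) +
          (w.sdeg + ((c.cob h₁).sdeg + (c.cob h₂).sdeg) - w'.sdeg)) := fun h₁ h₂ => by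
    rw [← Cob.sdeg_comp]
    exact mul_mem_coeffGrade (mul_mem_coeffGrade (mem_coeffGrade_sdegScalar _)
      (mem_coeffGrade_sdegScalar _)) (Cob.act_isHomog _ w w')
  -- Anticommutation makes the two entries opposite, so a single nonzero element is homogeneous of
  -- both degrees. The terms from `w` and `w'` are common and cancel.
  have hk := neg_mem (hmem k₁ k₂)
  rw [← eq_neg_of_add_eq_zero_left h] at hk
  have := coeffGrade_unique (hmem h₁ h₂) hk fun h0 =>
    hne ((ε h₁ * ε h₂).isUnit.mul_right_eq_zero.1 h0)
  have h' := congrArg (· - w.sdeg + w'.sdeg) this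
  convert h' using 1 <;> abel

/-- The closedness computation in additive notation, to be applied to the group of units. Here `e`
and `f` stand for $\epsilon$ and $\epsilon'$, `s` for the rescaling factors of the scalars
$\epsilon(\zeta)$, and `r` for those of the cobordisms. -/
theorem sub_add_add_sub_add_eq {G : Type} [AddCommGroup G]
    {e₁ e₂ e₃ e₄ f₁ f₂ f₃ f₄ r₁ r₂ r₃ r₄ s₁ s₂ s₃ s₄ : G}
    (h : (f₁ + f₂) - (f₃ + f₄) = ((s₁ + e₁) + (s₂ + e₂)) - ((s₃ + e₃) + (s₄ + e₄)))
    (h' : (s₁ + r₁) + (s₂ + r₂) = (s₃ + r₃) + (s₄ + r₄)) :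
    (f₁ - e₁ + r₁) + (f₂ - e₂ + r₂) = (f₃ - e₃ + r₃) + (f₄ - e₄ + r₄) := by
  linear_combination (norm := abel) h + h'

/-- The cochain that compares two sign assignments, after a change of parameters. -/
def comparison (φ : Coeff ≃+* Coeff) (ε ε' : EdgeCochain D Coeff) : EdgeCochain D Coeff :=
  fun _ _ _ h => ε' h / ε h * rescaling φ (c.cob h).sdeg

/-- As $\varphi$ multiplies $\epsilon(\zeta)$ by $\rho(\mathrm{sdeg}\,\epsilon(\zeta))$, the cochain
$\epsilon'/\epsilon$ has the coboundary of $\rho(\mathrm{sdeg}\,\epsilon)$. With the factor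
$\rho(\mathrm{sdeg}\,D_\zeta)$ this becomes the coboundary of
$\rho(\mathrm{sdeg}(\epsilon(\zeta)D_\zeta))$, which is trivial by `IsSignAssignment.sdeg_eq`. -/
theorem comparison_isClosed {φ : Coeff ≃+* Coeff}
    (hφ : ∀ (d : SDeg) (x : Coeff), x ∈ coeffGrade d → φ x ∈ coeffGrade d)
    (hXY : φ (X * Y) = X * Y) {ε ε' : EdgeCochain D Coeff}
    (hε : IsSignAssignment (RingHom.id Coeff) c ε)
    (h : CoboundaryMapsTo (φ : Coeff →+* Coeff) ε ε') : (comparison c φ ε ε').IsClosed := by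
  intro i j ξ ξ₁ ξ₂ ξ' h₁ h₂ k₁ k₂
  have hd := congrArg (rescaling φ) (hε.sdeg_eq h₁ h₂ k₁ k₂)
  rw [rescaling_add, rescaling_add, rescaling_add, rescaling_add, rescaling_add, rescaling_add]
    at hd
  have hδ := h h₁ h₂ k₁ k₂
  rw [map_div, map_mul, map_mul, unitsMap_eq_rescaling_mul hφ hXY,
    unitsMap_eq_rescaling_mul hφ hXY, unitsMap_eq_rescaling_mul hφ hXY,
    unitsMap_eq_rescaling_mul hφ hXY] at hδ
  exact sub_add_add_sub_add_eq (G := Additive Coeffˣ) hδ hd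

theorem coboundaryMapsTo_map (f : Coeff →+* Coeff) (ε : EdgeCochain D Coeff) :
    CoboundaryMapsTo f ε (ε.map f) := by
  intro i j ξ ξ₁ ξ₂ ξ' h₁ h₂ k₁ k₂
  simp only [EdgeCochain.map, map_div, map_mul]

/-- For $\epsilon'=\varphi(\epsilon)$ the quotient $\epsilon'/\epsilon$ is
$\rho(\mathrm{sdeg}\,\epsilon)$, so every edge contributes $\rho$ of the degree of the corrected
saddle. -/
theorem prod_comparison_map {φ : Coeff ≃+* Coeff}
    (hφ : ∀ (d : SDeg) (x : Coeff), x ∈ coeffGrade d → φ x ∈ coeffGrade d)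
    (hXY : φ (X * Y) = X * Y) (ε : EdgeCochain D Coeff) {ξ : D.Vertex} (P : CubePath D ξ) :
    P.prod (comparison c φ ε (ε.map (φ : Coeff →+* Coeff))) = rescaling φ (P.sdeg c ε) := by
  induction P with
  | nil => exact rescaling_zero.symm
  | snoc P h ih =>
    rw [CubePath.prod, CubePath.sdeg, ih, rescaling_add, rescaling_add, comparison,
      EdgeCochain.map, unitsMap_eq_rescaling_mul hφ hXY, mul_div_cancel_right]

end Comparison

/-! ### Rescaling generators -/

/-- The linear map that multiplies each generator by a scalar. -/
def scaleMap {n : ℕ} (g : Word n → Coeffˣ) : (Word n →₀ Coeff) →ₗ[Coeff] (Word n →₀ Coeff) :=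
  Finsupp.linearCombination Coeff fun u => .single u (g u : Coeff)

theorem scaleMap_single {n : ℕ} (g : Word n → Coeffˣ) (u : Word n) :
    scaleMap g (.single u 1) = (g u : Coeff) • .single u 1 := by
  simp [scaleMap]

theorem scaleMap_comp_inv {n : ℕ} (g : Word n → Coeffˣ) :
    scaleMap g ∘ₗ scaleMap g⁻¹ = LinearMap.id := by
  refine Finsupp.lhom_ext' fun u => LinearMap.ext_ring ?_
  simp only [LinearMap.comp_apply, Finsupp.lsingle_apply, scaleMap_single, map_smul, smul_smul,
    Pi.inv_apply, Units.inv_mul, one_smul, LinearMap.id_apply]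

theorem scaleMap_apply {n : ℕ} (g : Word n → Coeffˣ) (x : Word n →₀ Coeff) (u : Word n) :
    scaleMap g x u = g u * x u := by
  induction x using Finsupp.induction_linear with
  | zero => simp
  | add x y hx hy => simp only [map_add, Finsupp.add_apply, hx, hy, mul_add]
  | single w r =>
    classical
    simp only [scaleMap, Finsupp.linearCombination_single, Finsupp.smul_apply,
      Finsupp.single_apply]
    split_ifs with h
    · rw [h, smul_eq_mul, mul_comm]
    · simp

/-- Rescaling of generators, as an isomorphism of modules. -/
def scaleIso {n : ℕ} (g : Word n → Coeffˣ) :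
    ModuleCat.of Coeff (Word n →₀ Coeff) ≅ ModuleCat.of Coeff (Word n →₀ Coeff) where
  hom := ModuleCat.ofHom (scaleMap g)
  inv := ModuleCat.ofHom (scaleMap g⁻¹)
  hom_inv_id := by
    rw [← ModuleCat.ofHom_comp]
    exact congrArg ModuleCat.ofHom (by simpa using scaleMap_comp_inv g⁻¹)
  inv_hom_id := by
    rw [← ModuleCat.ofHom_comp]
    exact congrArg ModuleCat.ofHom (scaleMap_comp_inv g)

universe v u

/-! ### Diagonal isomorphisms between formal direct sums. -/

section Lift

variable {C : Type u} [Category.{v} C] [Preadditive C] {C' : Type u} [Category.{v} C']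
  [Preadditive C'] {E : Type u} [Category.{v} E] [Preadditive E] [HasFiniteBiproducts E]
  (F : C ⥤ E) [F.Additive] (G : C' ⥤ E) [G.Additive]

/-- Isomorphisms between summands induce an isomorphism of formal direct sums. -/
def liftIso {J : Type} [Fintype J] {x : J → C} {y : J → C'} (e : ∀ j, F.obj (x j) ≅ G.obj (y j)) :
    (Mat_.lift F).obj ⟨J, x⟩ ≅ (Mat_.lift G).obj ⟨J, y⟩ :=
  biproduct.mapIso e

/-- Composing a matrix with diagonal isomorphisms acts entry by entry, so commutation of the square
is a condition on single entries. -/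
theorem liftIso_comm {J K : Type} [Fintype J] [Fintype K] {x : J → C} {y : J → C'} {x' : K → C}
    {y' : K → C'} (e : ∀ j, F.obj (x j) ≅ G.obj (y j)) (e' : ∀ j, F.obj (x' j) ≅ G.obj (y' j))
    (f : (⟨J, x⟩ : Mat_ C) ⟶ ⟨K, x'⟩) (g : (⟨J, y⟩ : Mat_ C') ⟶ ⟨K, y'⟩)
    (h : ∀ j k, (e j).hom ≫ G.map (g j k) = F.map (f j k) ≫ (e' k).hom) :
    (liftIso F G e).hom ≫ (Mat_.lift G).map g = (Mat_.lift F).map f ≫ (liftIso F G e').hom :=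
  (biproduct.map_matrix _ _).trans
    ((congrArg biproduct.matrix (funext fun j => funext fun k => h j k)).trans
      (biproduct.matrix_map _ _).symm)

theorem ι_liftIso {J : Type} [Fintype J] {x : J → C} {y : J → C'}
    (e : ∀ j, F.obj (x j) ≅ G.obj (y j)) (j : J) :
    biproduct.ι (fun j => F.obj (x j)) j ≫ (liftIso F G e).hom =
      (e j).hom ≫ biproduct.ι (fun j => G.obj (y j)) j :=
  biproduct.ι_map (fun j => (e j).hom) j

end Lift
-- The complex of modules in terms of generators and matrix entries.
section Circles

variable {R : Type} [CommRing R] (θ : Coeff →+* R)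

/-- The value of the chronological TQFT on a collection of circles. -/
def circlesIso (n : ℕ) : ModuleCat.of R (Word n →₀ R) ≅ (tqft θ).obj (ChCob.circles θ n) :=
  Iso.refl _

open Classical in
theorem tqft_map_khEntry {D : LinkDiagram} (c : Decoration D) (ε : EdgeCochain D R)
    (ξ ξ' : D.Vertex) :
    (circlesIso θ (c.size ξ)).hom ≫ (tqft θ).map (khEntry θ c ε ξ ξ') =
      ModuleCat.ofHom (∑ i, if h : IsEdge i ξ ξ' then (ε h : R) • (c.cob h).act θ else 0) ≫
        (circlesIso θ (c.size ξ')).hom := by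
  rw [khEntry, Functor.map_sum]
  refine (Category.id_comp _).trans (Eq.trans ?_ (Category.comp_id _).symm)
  refine (Finset.sum_congr rfl fun i _ => ?_).trans
    (map_sum (ModuleCat.homAddEquiv (M := ModuleCat.of R (Word (c.size ξ) →₀ R))
      (N := ModuleCat.of R (Word (c.size ξ') →₀ R))).symm _ _).symm
  split_ifs with h
  · exact tqft_map_smul_mk θ _ _
  · exact Functor.map_zero _ _ _

theorem khGen_eq {D : LinkDiagram} (c : Decoration D) {ε : EdgeCochain D R}
    (hε : IsSignAssignment θ c ε) {q : ℤ} {ξ : D.Vertex}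
    (hξ : (weight ξ : ℤ) = q + D.negative) (u : Word (c.size ξ)) :
    khGen θ c hε hξ u = ((circlesIso θ (c.size ξ)).hom ≫
      biproduct.ι (fun ξ : {ξ : D.Vertex // (weight ξ : ℤ) = q + D.negative} =>
        (tqft θ).obj (ChCob.circles θ (c.size ξ.1))) ⟨ξ, hξ⟩).hom (.single u 1) := rfl

theorem khModule_d {D : LinkDiagram} (c : Decoration D) {ε : EdgeCochain D R}
    (hε : IsSignAssignment θ c ε) (q : ℤ) :
    (khModule θ c hε).d q (q + 1) = (Mat_.lift (tqft θ)).map (khD θ c ε q) :=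
  congrArg (Mat_.lift (tqft θ)).map (CochainComplex.of_d (khObj θ c) (khD θ c ε) q)

end Circles

theorem comp_sum_eq_sum_comp {R M N : Type} [CommRing R] [AddCommGroup M] [AddCommGroup N]
    [Module R M] [Module R N] {ι : Type} [Fintype ι] {f : M →ₗ[R] M} {g : N →ₗ[R] N}
    {s t : ι → M →ₗ[R] N} (h : ∀ i, g ∘ₗ s i = t i ∘ₗ f) :
    g ∘ₗ (∑ i, s i) = (∑ i, t i) ∘ₗ f := by
  refine LinearMap.ext fun x => ?_
  simp only [LinearMap.comp_apply, LinearMap.sum_apply, map_sum]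
  exact Finset.sum_congr rfl fun i _ => LinearMap.congr_fun (h i) x

/-! ### The isomorphism of complexes. -/

section Iso

variable {φ : Coeff ≃+* Coeff} {D : LinkDiagram} (c : Decoration D) (ε ε' : EdgeCochain D Coeff)
  (P : ∀ ξ : D.Vertex, CubePath D ξ)

variable (φ) in
/-- The factor by which the generator `u` at the vertex `ξ` is multiplied. -/
def genScale (ξ : D.Vertex) (u : Word (c.size ξ)) : Coeffˣ :=
  rescaling φ u.sdeg * (P ξ).prod (comparison c φ ε ε')

/-- The identity of scalars behind `scaleMap_comp_act`, in additive notation: `e`, `f` are the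
values of $\epsilon$, $\epsilon'$ on the edge, `p` is the product along the path to its source, and
`r`, `u`, `v` are the rescaling factors of the cobordism and of the two generators. -/
theorem add_add_sub_add_eq {G : Type} [AddCommGroup G] {e f p r u v : G} (h : u + u = 0) :
    e + (v + (p + (f - e + r))) = (u + p) + (f + (u + r + v)) := by
  linear_combination (norm := abel) -h

variable {c ε ε'} in
-- If $x$ is the matrix entry from $u$ to $u'$, the twisted entry is
-- $\varphi(x)=\rho(\mathrm{sdeg}\,u)\rho(\mathrm{sdeg}\,D_\zeta)\rho(\mathrm{sdeg}\,u')x$. The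
-- factors of the generators are absorbed by `genScale`, and the rest is the value of the comparison
-- cochain.
theorem scaleMap_comp_act
    (hφ : ∀ (d : SDeg) (x : Coeff), x ∈ coeffGrade d → φ x ∈ coeffGrade d)
    (hXY : φ (X * Y) = X * Y) (hε : IsSignAssignment (RingHom.id Coeff) c ε)
    (h : CoboundaryMapsTo (φ : Coeff →+* Coeff) ε ε') {i : Fin D.crossings} {ξ ξ' : D.Vertex}
    (e : IsEdge i ξ ξ') :
    scaleMap (genScale φ c ε ε' P ξ') ∘ₗ ((ε e : Coeff) • (c.cob e).act (RingHom.id Coeff)) =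
      ((ε' e : Coeff) • (c.cob e).act (φ : Coeff →+* Coeff)) ∘ₗ
        scaleMap (genScale φ c ε ε' P ξ) := by
  -- The chosen path to `ξ'` need not extend the one to `ξ`; closedness allows it to be replaced by
  -- the path that does.
  have hP : (P ξ').prod (comparison c φ ε ε') =
      (P ξ).prod (comparison c φ ε ε') * (ε' e / ε e * rescaling φ (c.cob e).sdeg) :=
    (comparison_isClosed c hφ hXY hε h).prod_eq (P ξ') ((P ξ).snoc e)
  refine Finsupp.lhom_ext' fun u => LinearMap.ext_ring (Finsupp.ext fun u' => ?_)
  simp only [LinearMap.comp_apply, Finsupp.lsingle_apply, scaleMap_single, map_smul,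
    LinearMap.smul_apply, Finsupp.smul_apply, smul_eq_mul, scaleMap_apply]
  rw [Cob.act_single_apply (φ : Coeff →+* Coeff)]
  have hc := map_eq_rescaling_mul hφ hXY ((c.cob e).act_isHomog u u')
  generalize (c.cob e).act (RingHom.id Coeff) (.single u 1) u' = x at hc
  rw [RingEquiv.coe_toRingHom, hc, sub_eq_add_neg, rescaling_add, rescaling_add,
    rescaling_neg hφ, genScale, genScale, hP]
  -- The factor of `u` occurs twice on the twisted side, once from rescaling `u` and once from the
  -- matrix entry.
  have hsq : rescaling φ u.sdeg * rescaling φ u.sdeg = 1 := by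
    nth_rw 1 [← rescaling_neg hφ]
    rw [← rescaling_add, neg_add_cancel, rescaling_zero]
  have key := congrArg Units.val (add_add_sub_add_eq (G := Additive Coeffˣ) (e := ε e) (f := ε' e)
    (p := (P ξ).prod (comparison c φ ε ε')) (r := rescaling φ (c.cob e).sdeg)
    (v := rescaling φ u'.sdeg) hsq)
  calc _ = (_ : Coeff) * x := (mul_assoc _ _ _).symm
    _ = _ * x := congrArg (· * x) ((Units.val_mul _ _).symm.trans key)
    _ = _ := by
      refine (congrArg (· * x) ((Units.val_mul _ _).trans (congrArg (_ * ·)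
        (Units.val_mul _ _)))).trans ?_
      rw [mul_assoc, mul_assoc]
      rfl

/-- Rescaling of generators, for the values of the functors. -/
def vertexIso (θ θ' : Coeff →+* Coeff) {n : ℕ} (g : Word n → Coeffˣ) :
    (tqft θ).obj (ChCob.circles θ n) ≅ (tqft θ').obj (ChCob.circles θ' n) :=
  (circlesIso θ n).symm ≪≫ scaleIso g ≪≫ circlesIso θ' n

variable {c ε ε'} in
theorem vertexIso_comp_khEntry
    (hφ : ∀ (d : SDeg) (x : Coeff), x ∈ coeffGrade d → φ x ∈ coeffGrade d)
    (hXY : φ (X * Y) = X * Y) (hε : IsSignAssignment (RingHom.id Coeff) c ε)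
    (h : CoboundaryMapsTo (φ : Coeff →+* Coeff) ε ε') (ξ ξ' : D.Vertex) :
    (vertexIso (RingHom.id Coeff) (φ : Coeff →+* Coeff) (genScale φ c ε ε' P ξ)).hom ≫
        (tqft (φ : Coeff →+* Coeff)).map (khEntry (φ : Coeff →+* Coeff) c ε' ξ ξ') =
      (tqft (RingHom.id Coeff)).map (khEntry (RingHom.id Coeff) c ε ξ ξ') ≫
        (vertexIso (RingHom.id Coeff) (φ : Coeff →+* Coeff) (genScale φ c ε ε' P ξ')).hom := by
  classical
  have hS : (scaleIso (genScale φ c ε ε' P ξ)).hom ≫ ModuleCat.ofHom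
        (∑ i, if h : IsEdge i ξ ξ' then (ε' h : Coeff) • (c.cob h).act (φ : Coeff →+* Coeff) else 0) =
      ModuleCat.ofHom (∑ i, if h : IsEdge i ξ ξ' then
        (ε h : Coeff) • (c.cob h).act (RingHom.id Coeff) else 0) ≫
          (scaleIso (genScale φ c ε ε' P ξ')).hom := by
    refine congrArg ModuleCat.ofHom (comp_sum_eq_sum_comp fun i => ?_).symm
    split_ifs with e
    · exact scaleMap_comp_act P hφ hXY hε h e
    · rw [LinearMap.comp_zero, LinearMap.zero_comp]
  rw [← cancel_epi (circlesIso (RingHom.id Coeff) (c.size ξ)).hom, ← Category.assoc (Iso.hom _) _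
    (Iso.hom _), tqft_map_khEntry]
  simp only [vertexIso, Iso.trans_hom, Iso.symm_hom, Category.assoc, Iso.hom_inv_id_assoc,
    tqft_map_khEntry]
  rw [reassoc_of% hS]

variable (φ) in
/-- The rescaling of generators in a given degree. -/
def degreeIso (q : ℤ) : (Mat_.lift (tqft (RingHom.id Coeff))).obj (khObj (RingHom.id Coeff) c q) ≅
    (Mat_.lift (tqft (φ : Coeff →+* Coeff))).obj (khObj (φ : Coeff →+* Coeff) c q) :=
  liftIso (tqft (RingHom.id Coeff)) (tqft (φ : Coeff →+* Coeff))
    (J := {ξ : D.Vertex // (weight ξ : ℤ) = q + D.negative})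
    (x := fun ξ => ChCob.circles (RingHom.id Coeff) (c.size ξ.1))
    (y := fun ξ => ChCob.circles (φ : Coeff →+* Coeff) (c.size ξ.1))
    fun ξ => vertexIso (RingHom.id Coeff) (φ : Coeff →+* Coeff) (genScale φ c ε ε' P ξ.1)

variable {c ε ε'} in
theorem degreeIso_comm
    (hφ : ∀ (d : SDeg) (x : Coeff), x ∈ coeffGrade d → φ x ∈ coeffGrade d)
    (hXY : φ (X * Y) = X * Y) (hε : IsSignAssignment (RingHom.id Coeff) c ε)
    (h : CoboundaryMapsTo (φ : Coeff →+* Coeff) ε ε') (q : ℤ) :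
    (degreeIso φ c ε ε' P q).hom ≫
        (Mat_.lift (tqft (φ : Coeff →+* Coeff))).map (khD (φ : Coeff →+* Coeff) c ε' q) =
      (Mat_.lift (tqft (RingHom.id Coeff))).map (khD (RingHom.id Coeff) c ε q) ≫
        (degreeIso φ c ε ε' P (q + 1)).hom :=
  liftIso_comm _ _ _ _ _ _ fun ξ ξ' => vertexIso_comp_khEntry P hφ hXY hε h ξ.1 ξ'.1

variable {c ε ε'} in
theorem degreeIso_khGen (hε : IsSignAssignment (RingHom.id Coeff) c ε)
    (hε' : IsSignAssignment (φ : Coeff →+* Coeff) c ε') (q : ℤ) {ξ : D.Vertex}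
    (hξ : (weight ξ : ℤ) = q + D.negative) (u : Word (c.size ξ)) :
    (degreeIso φ c ε ε' P q).hom.hom (khGen (RingHom.id Coeff) c hε hξ u) =
      (genScale φ c ε ε' P ξ u : Coeff) • khGen (φ : Coeff →+* Coeff) c hε' hξ u := by
  have h1 := ι_liftIso (tqft (RingHom.id Coeff)) (tqft (φ : Coeff →+* Coeff))
    (x := fun ξ => ChCob.circles (RingHom.id Coeff) (c.size ξ.1))
    (y := fun ξ => ChCob.circles (φ : Coeff →+* Coeff) (c.size ξ.1))
    (fun ξ : {ξ : D.Vertex // (weight ξ : ℤ) = q + D.negative} =>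
      vertexIso (RingHom.id Coeff) (φ : Coeff →+* Coeff) (genScale φ c ε ε' P ξ.1)) ⟨ξ, hξ⟩
  have h2 := congrArg ((circlesIso (RingHom.id Coeff) (c.size ξ)).hom ≫ ·) h1
  simp only [vertexIso, Iso.trans_hom, Iso.symm_hom, Category.assoc] at h2
  have h3 := LinearMap.congr_fun (congrArg ModuleCat.Hom.hom h2)
    (Finsupp.single u 1 : Word (c.size ξ) →₀ Coeff)
  rw [khGen_eq, khGen_eq]
  refine h3.trans ?_
  refine (congrArg ((circlesIso (φ : Coeff →+* Coeff) (c.size ξ)).hom ≫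
      biproduct.ι (fun ξ : {ξ : D.Vertex // (weight ξ : ℤ) = q + D.negative} =>
        (tqft (φ : Coeff →+* Coeff)).obj (ChCob.circles (φ : Coeff →+* Coeff) (c.size ξ.1)))
          ⟨ξ, hξ⟩).hom (scaleMap_single (genScale φ c ε ε' P ξ) u)).trans ?_
  exact map_smul _ _ _

variable {c ε ε'} in
/-- The rescaling of generators is an isomorphism of complexes. -/
theorem exists_iso
    (hφ : ∀ (d : SDeg) (x : Coeff), x ∈ coeffGrade d → φ x ∈ coeffGrade d)
    (hXY : φ (X * Y) = X * Y) (hε : IsSignAssignment (RingHom.id Coeff) c ε)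
    (hε' : IsSignAssignment (φ : Coeff →+* Coeff) c ε')
    (h : CoboundaryMapsTo (φ : Coeff →+* Coeff) ε ε') :
    ∃ Φ : khModule (RingHom.id Coeff) c hε ≅ khModule (φ : Coeff →+* Coeff) c hε',
      ∀ (q : ℤ) (ξ : D.Vertex) (hξ : (weight ξ : ℤ) = q + D.negative) (u : Word (c.size ξ)),
        (Φ.hom.f q).hom (khGen (RingHom.id Coeff) c hε hξ u) =
          (genScale φ c ε ε' P ξ u : Coeff) • khGen (φ : Coeff →+* Coeff) c hε' hξ u := by
  refine ⟨HomologicalComplex.Hom.isoOfComponents (fun q => degreeIso φ c ε ε' P q) ?_,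
    fun q ξ hξ u => degreeIso_khGen P hε hε' q hξ u⟩
  rintro q _ rfl
  rw [khModule_d, khModule_d]
  exact degreeIso_comm P hφ hXY hε h q

end Iso

end GenKh

end

theorem mainTheorem4 (φ : GenKh.Coeff ≃+* GenKh.Coeff)
    (hφ : ∀ (d : GenKh.SDeg) (x : GenKh.Coeff),
      x ∈ GenKh.coeffGrade d → φ x ∈ GenKh.coeffGrade d)
    (hXY : φ (GenKh.X * GenKh.Y) = GenKh.X * GenKh.Y)
    (D : GenKh.LinkDiagram) (c : GenKh.Decoration D)
    (ε : GenKh.EdgeCochain D GenKh.Coeff)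
    (hε : GenKh.IsSignAssignment (RingHom.id GenKh.Coeff) c ε) :
    -- an isomorphism of complexes, for all corresponding sign assignments
    (∀ (ε' : GenKh.EdgeCochain D GenKh.Coeff)
      (hε' : GenKh.IsSignAssignment (φ : GenKh.Coeff →+* GenKh.Coeff) c ε'),
      GenKh.CoboundaryMapsTo (φ : GenKh.Coeff →+* GenKh.Coeff) ε ε' →
      Nonempty (GenKh.khModule (RingHom.id GenKh.Coeff) c hε ≅
        GenKh.khModule (φ : GenKh.Coeff →+* GenKh.Coeff) c hε')) ∧
    -- the explicit isomorphism, for the image of the sign assignment under `φ`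
    ∃ hφε : GenKh.IsSignAssignment (φ : GenKh.Coeff →+* GenKh.Coeff) c
        (ε.map (φ : GenKh.Coeff →+* GenKh.Coeff)),
      ∀ P : ∀ ξ : D.Vertex, GenKh.CubePath D ξ,
        ∃ Φ : GenKh.khModule (RingHom.id GenKh.Coeff) c hε ≅
            GenKh.khModule (φ : GenKh.Coeff →+* GenKh.Coeff) c hφε,
          ∀ (q : ℤ) (ξ : D.Vertex)
            (hξ : (GenKh.LinkDiagram.weight ξ : ℤ) = q + D.negative)
            (u : GenKh.Word (c.size ξ)),
            (Φ.hom.f q).hom (GenKh.khGen (RingHom.id GenKh.Coeff) c hε hξ u) =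
              (GenKh.rescaling φ (GenKh.genSDeg c ε (P ξ) u) : GenKh.Coeff) •
                GenKh.khGen (φ : GenKh.Coeff →+* GenKh.Coeff) c hφε hξ u := by
  refine ⟨fun ε' hε' h => ?_, hε.map _, fun P => ?_⟩
  -- Any choice of paths serves for the existence of an isomorphism.
  · obtain ⟨Φ, -⟩ := GenKh.exists_iso
      (fun ξ => (GenKh.nonempty_cubePath ξ).some) hφ hXY hε hε' h
    exact ⟨Φ⟩
  · obtain ⟨Φ, hΦ⟩ := GenKh.exists_iso P hφ hXY hε (hε.map _)
      (GenKh.coboundaryMapsTo_map (φ : GenKh.Coeff →+* GenKh.Coeff) ε)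
    refine ⟨Φ, fun q ξ hξ u => (hΦ q ξ hξ u).trans ?_⟩
    -- The scale factor is $\rho(\mathrm{sdeg}\,u)\rho(\mathrm{sdeg}\,W_\xi)$; since
    -- $\rho(-d)=\rho(d)$, this is $\rho$ of the difference of the degrees.
    rw [GenKh.genScale, GenKh.prod_comparison_map c hφ hXY, GenKh.genSDeg, sub_eq_add_neg,
      GenKh.rescaling_add, GenKh.rescaling_neg hφ]
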